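/- A \emph{clique} of a finite simple graph $G$ is an inclusion-maximal set of pairwise adjacent vertices, and a \emph{$k$-clique coloring} of $G$ is a map $f:V(G)\to\{1,\dots,k\}$ such that no clique with at least two vertices is monocolored. A \emph{$B_1$-EPG representation} of $G$ assigns to every vertex $v$ a path $P_v$ of the two-dimensional grid with at least one edge and at most one bend (i.e. $P_v$ is a single horizontal or vertical segment, or a horizontal and a vertical segment sharing an end point), such that two distinct vertices $u,v$ are adjacent if and only if $P_u$ and $P_v$ share at least one edge of the grid. $G$ is a \emph{$B_1$-EPG graph} if it has such a representation. \textbf{Theorem.} Every finite $B_1$-EPG graph has a $4$-clique coloring. Moreover, there is an algorithm which, given a graph $G$ with $n$ vertices and $m$ edges (by the list of its edges, in any order) together with a $B_1$-EPG representation of $G$ (each path being described by the four integers $x',x,y,y'$ for which it runs from $(x',y)$ straight to $(x,y)$ and then straight to $(x,y')$), computes in time $O(n+m)$ a $4$-clique coloring of $G$ in which one of the (possibly empty) color classes is an independent set. Here the time is the number of steps on a random access machine with integer cells, initially zero outside the input, on which reading or writing a cell with a computed address, addition, subtraction and comparison cost one step each and no other arithmetic is available; the constant in $O(n+m)$ is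 absolute (independent of the graph and of the coordinates), and for $n=0$ the bound is read as $O(1)$. -/

import Mathlib

/-! ### Clique colorings -/

/-- A clique of `G` is an inclusion-maximal complete set of vertices. -/
def IsMaxClique {V : Type*} (G : SimpleGraph V) (s : Set V) : Prop :=
  Maximal G.IsClique s

/-- `f` is a `k`-clique coloring: no maximal clique with at least two vertices is monocolored. -/
def IsCliqueColoring {V : Type*} (G : SimpleGraph V) {k : ℕ} (f : V → Fin k) : Prop :=
  ∀ s : Set V, IsMaxClique G s → s.Nontrivial → ¬ ∃ c : Fin k, ∀ v ∈ s, f v = c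

/-- `G` is `k`-clique colorable. -/
def CliqueColorable {V : Type*} (G : SimpleGraph V) (k : ℕ) : Prop :=
  ∃ f : V → Fin k, IsCliqueColoring G f

/-! ### One-bend paths on the grid `ℤ × ℤ` and `B₁`-EPG representations -/

/-- A path of the two-dimensional grid with at least one edge and at most one bend.  It runs
straight along row `y` from the point `(x', y)` to the point `(x, y)`, and then straight along
column `x` from `(x, y)` to `(x, y')`.  If both parts have positive length the path bends at
`(x, y)`; if `y' = y` it is a single horizontal segment, if `x' = x` a single vertical one. -/
structure GridPath where
  x' : ℤ
  x : ℤ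
  y : ℤ
  y' : ℤ
  nontrivial : x' ≠ x ∨ y' ≠ y

/-- The grid edges (unordered pairs of neighbouring grid points) of a path. -/
def GridPath.edges (p : GridPath) : Set (Sym2 (ℤ × ℤ)) :=
  {e | ∃ i : ℤ, min p.x' p.x ≤ i ∧ i < max p.x' p.x ∧ e = s((i, p.y), (i + 1, p.y))} ∪
  {e | ∃ j : ℤ, min p.y' p.y ≤ j ∧ j < max p.y' p.y ∧ e = s((p.x, j), (p.x, j + 1))}

/-- The paths `P v` form a `B₁`-EPG representation of `G`: two distinct vertices are adjacent if
and only if their paths share at least one grid edge. -/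
def IsB1EPGRepresentation {V : Type*} (G : SimpleGraph V) (P : V → GridPath) : Prop :=
  ∀ u v : V, u ≠ v → (G.Adj u v ↔ ((P u).edges ∩ (P v).edges).Nonempty)

/-- `G` is a `B₁`-EPG graph. -/
def IsB1EPG {V : Type*} (G : SimpleGraph V) : Prop :=
  ∃ P : V → GridPath, IsB1EPGRepresentation G P

/-! ### A unit-cost random access machine

The memory consists of arrays of integer cells.  A program is a fixed finite text, so it uses only
a fixed number of arrays (which could be interleaved into a single one at the price of a constant
factor).  Reading or writing a cell whose index was computed, adding, subtracting and comparing
cost one step each; there is no multiplication. -/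

namespace RAM

/-- `s a i` is the content of cell `i` of array `a`. -/
abbrev State := ℕ → ℤ → ℤ

/-- Integer expressions; `get a e` reads the cell of array `a` whose index is the value of `e`. -/
inductive Expr where
  | lit (z : ℤ)
  | get (a : ℕ) (e : Expr)
  | add (e₁ e₂ : Expr)
  | sub (e₁ e₂ : Expr)

def Expr.eval (s : State) : Expr → ℤ
  | lit z => z
  | get a e => s a (e.eval s)
  | add e₁ e₂ => e₁.eval s + e₂.eval s
  | sub e₁ e₂ => e₁.eval s - e₂.eval s

/-- The number of steps needed to evaluate an expression. -/
def Expr.cost : Expr → ℕ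
  | lit _ => 1
  | get _ e => e.cost + 1
  | add e₁ e₂ => e₁.cost + e₂.cost + 1
  | sub e₁ e₂ => e₁.cost + e₂.cost + 1

/-- Tests. -/
inductive Test where
  | le (e₁ e₂ : Expr)
  | eq (e₁ e₂ : Expr)
  | not (b : Test)
  | and (b₁ b₂ : Test)

def Test.Holds (s : State) : Test → Prop
  | le e₁ e₂ => e₁.eval s ≤ e₂.eval s
  | eq e₁ e₂ => e₁.eval s = e₂.eval s
  | not b => ¬ b.Holds s
  | and b₁ b₂ => b₁.Holds s ∧ b₂.Holds s

/-- The number of steps needed to evaluate a test. -/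
def Test.cost : Test → ℕ
  | le e₁ e₂ => e₁.cost + e₂.cost + 1
  | eq e₁ e₂ => e₁.cost + e₂.cost + 1
  | not b => b.cost + 1
  | and b₁ b₂ => b₁.cost + b₂.cost + 1

/-- Programs; `assign a e₁ e₂` writes the value of `e₂` into the cell of array `a` whose index is
the value of `e₁`, and `loop b c` is the loop "while `b` do `c`". -/
inductive Program where
  | skip
  | assign (a : ℕ) (e₁ e₂ : Expr)
  | seq (c₁ c₂ : Program)
  | branch (b : Test) (c₁ c₂ : Program)
  | loop (b : Test) (c : Program)

/-- `Exec c s t s'`: started in state `s`, the program `c` halts after exactly `t` steps in state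
`s'`. -/
inductive Exec : Program → State → ℕ → State → Prop where
  | skip (s : State) : Exec .skip s 1 s
  | assign (s : State) (a : ℕ) (e₁ e₂ : Expr) :
      Exec (.assign a e₁ e₂) s (e₁.cost + e₂.cost + 1)
        (Function.update s a (Function.update (s a) (e₁.eval s) (e₂.eval s)))
  | seq {c₁ c₂ : Program} {s₀ s₁ s₂ : State} {t₁ t₂ : ℕ} :
      Exec c₁ s₀ t₁ s₁ → Exec c₂ s₁ t₂ s₂ → Exec (.seq c₁ c₂) s₀ (t₁ + t₂) s₂
  | branch_true {b : Test} {c₁ c₂ : Program} {s s' : State} {t : ℕ} :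
      b.Holds s → Exec c₁ s t s' → Exec (.branch b c₁ c₂) s (b.cost + t + 1) s'
  | branch_false {b : Test} {c₁ c₂ : Program} {s s' : State} {t : ℕ} :
      ¬ b.Holds s → Exec c₂ s t s' → Exec (.branch b c₁ c₂) s (b.cost + t + 1) s'
  | loop_done {b : Test} {c : Program} {s : State} :
      ¬ b.Holds s → Exec (.loop b c) s (b.cost + 1) s
  | loop_step {b : Test} {c : Program} {s₀ s₁ s₂ : State} {t₁ t₂ : ℕ} :
      b.Holds s₀ → Exec c s₀ t₁ s₁ → Exec (.loop b c) s₁ t₂ s₂ →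
        Exec (.loop b c) s₀ (b.cost + t₁ + t₂ + 1) s₂

/-- The array that holds the list `l` in its cells `0, 1, …` and zeros elsewhere. -/
def cells (l : List ℤ) : ℤ → ℤ :=
  fun i => if 0 ≤ i then l.getD i.toNat 0 else 0

/-- The initial memory for a graph on `Fin n` that is given by a list `E` of its edges together
with one-bend paths `P`: array `0` holds the number of vertices and the number of edges, arrays `1`
to `4` the coordinates `x'`, `x`, `y`, `y'` of the paths, and arrays `5` and `6` the two ends of
each edge.  All other cells are zero. -/
def input {n : ℕ} (P : Fin n → GridPath) (E : List (Fin n × Fin n)) : State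
  | 0 => cells [(n : ℤ), (E.length : ℤ)]
  | 1 => cells (List.ofFn fun v => (P v).x')
  | 2 => cells (List.ofFn fun v => (P v).x)
  | 3 => cells (List.ofFn fun v => (P v).y)
  | 4 => cells (List.ofFn fun v => (P v).y')
  | 5 => cells (E.map fun e => ((e.1 : ℕ) : ℤ))
  | 6 => cells (E.map fun e => ((e.2 : ℕ) : ℤ))
  | _ => fun _ => 0

/-- In the memory `s`, the cells `0, …, n - 1` of array `7` hold the values of `f`. -/
def Outputs {n k : ℕ} (s : State) (f : Fin n → Fin k) : Prop :=
  ∀ v : Fin n, s 7 ((v : ℕ) : ℤ) = ((f v : ℕ) : ℤ)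

end RAM

/-- The list `E` contains every edge of `G` exactly once (in any order, with the two ends of each
edge in any order), and nothing else. -/
def IsEdgeList {V : Type*} (G : SimpleGraph V) (E : List (V × V)) : Prop :=
  (E.map fun e => s(e.1, e.2)).Nodup ∧
    ∀ e : Sym2 V, e ∈ (E.map fun e => s(e.1, e.2)) ↔ e ∈ G.edgeSet

/-! ### Rows, columns and the structure of cliques -/

namespace GridPath

/-! Pairwise meeting one-bend paths have a simple shape (`clique_cases`): they share a grid edge, or
they form a claw, each path using two of three edges at a grid point. Up to reflection in the
diagonal, two of these edges are horizontal and one is vertical.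

Two sets of vertices are selected, `H` by looking at rows and `W` by looking at columns, and the two
membership bits are the color. Each set is a kernel of an acyclic relation `Blocks`: order the
horizontal parts by left end, then type, then vertex, and reject a path if an earlier selected path
contains its first horizontal edge. Were this the whole rule, selected paths would share no row
edge, and the last path of a clique on a row edge would be selected or be blocked by a selected path
that maximality puts into the clique. So no such clique would be homogeneous.

A claw with no selected path can still occur: the path that bends at the left end of its horizontal
part may be blocked by one that bends at the same point in the opposite direction and is not in the
clique. Therefore an upward bend does not block a downward one when `ex` holds, which requires that
some path starting further left contains the same first edge. For rows this exception is made
whenever such a path exists, which settles row claws; the price is that some adjacent pairs are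
selected together, but only with types 0 and 1 and a common bend (`IsKernel.pair`).

For columns the exception is restricted to vertices outside `H`, so that two vertices selected both
times share no column edge; and `ColExtra` lets one vertex of each exceptional row pair block the
other in the columns. Hence the color 3 is independent (`not_adj_of_selected`). A column claw
without vertices of `W` must contain a vertex of `H`; if it lies entirely in `H`, two of its paths
share a row edge with types that `IsKernel.pair` forbids (`not_monochromatic`).

For the running time, blocking relates only adjacent vertices and is decided in constant time from
tabulated ends and types. A kernel is therefore found by traversing the edges in topological order
(`runs_findKernel`), without sorting coordinates. -/

/-- The left end of the horizontal part. -/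
def lo (p : GridPath) : ℤ := min p.x' p.x

/-- The right end of the horizontal part. -/
def hi (p : GridPath) : ℤ := max p.x' p.x

/-- `0` if the horizontal part has a bend upwards at its left end, `1` if it has a bend downwards
there, and `2` otherwise. -/
def typ (p : GridPath) : ℤ :=
  if p.x < p.x' ∧ p.y < p.y' then 0 else if p.x < p.x' ∧ p.y' < p.y then 1 else 2

/-- The reflection of a path in the diagonal of the grid. -/
def flip (p : GridPath) : GridPath := ⟨p.y', p.y, p.x, p.x', p.nontrivial.symm⟩

/-- The horizontal parts of the two paths share an edge. -/
def RowShare (p q : GridPath) : Prop :=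
  p.y = q.y ∧ p.lo < p.hi ∧ q.lo < q.hi ∧ p.lo < q.hi ∧ q.lo < p.hi

/-- The two paths share an edge. -/
def Meets (p q : GridPath) : Prop := p.RowShare q ∨ p.flip.RowShare q.flip

theorem typ_eq_zero {p : GridPath} : p.typ = 0 ↔ p.x < p.x' ∧ p.y < p.y' := by
  unfold typ; split_ifs <;> omega

theorem typ_eq_one {p : GridPath} : p.typ = 1 ↔ p.x < p.x' ∧ p.y' < p.y := by
  unfold typ; split_ifs <;> omega

theorem typ_cases (p : GridPath) : p.typ = 0 ∨ p.typ = 1 ∨ p.typ = 2 := by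
  unfold typ; split_ifs <;> simp

theorem meets_flip {p q : GridPath} : p.flip.Meets q.flip ↔ p.Meets q := by
  exact or_comm

theorem RowShare.symm {p q : GridPath} (h : p.RowShare q) : q.RowShare p := by
  unfold RowShare at *; omega

theorem meets_self (p : GridPath) : p.Meets p := by
  have := p.nontrivial
  simp only [Meets, RowShare, lo, hi, flip, true_and]; omega

/-- A horizontal edge is never a vertical one, so a common edge lies in a common row or column.
Conversely, two overlapping intervals share the edge that starts at the larger of their lower ends.
-/
theorem edges_inter_nonempty {p q : GridPath} : (p.edges ∩ q.edges).Nonempty ↔ p.Meets q := by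
  simp only [Meets, RowShare, lo, hi, flip]
  constructor
  · rintro ⟨e, ⟨i, h₁, h₂, rfl⟩ | ⟨i, h₁, h₂, rfl⟩, ⟨j, h₃, h₄, h⟩ | ⟨j, h₃, h₄, h⟩⟩ <;>
      simp only [Sym2.eq_iff, Prod.mk.injEq] at h <;> omega
  · rintro (h | h)
    · exact ⟨s((max (min p.x' p.x) (min q.x' q.x), p.y),
        (max (min p.x' p.x) (min q.x' q.x) + 1, p.y)),
        Or.inl ⟨max (min p.x' p.x) (min q.x' q.x), by omega, by omega, rfl⟩,
        Or.inl ⟨max (min p.x' p.x) (min q.x' q.x), by omega, by omega, by rw [h.1]⟩⟩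
    · exact ⟨s((p.x, max (min p.y' p.y) (min q.y' q.y)),
        (p.x, max (min p.y' p.y) (min q.y' q.y) + 1)),
        Or.inr ⟨max (min p.y' p.y) (min q.y' q.y), by omega, by omega, rfl⟩,
        Or.inr ⟨max (min p.y' p.y) (min q.y' q.y), by omega, by omega, by rw [h.1]⟩⟩

end GridPath

open GridPath

section Cliques

variable {V : Type*} {G : SimpleGraph V} {P : V → GridPath} {K : Set V}

/-- Distinct vertices are adjacent exactly if their paths meet. -/
def Represents (G : SimpleGraph V) (P : V → GridPath) : Prop :=
  ∀ u v, u ≠ v → (G.Adj u v ↔ (P u).Meets (P v))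

theorem IsB1EPGRepresentation.represents (h : IsB1EPGRepresentation G P) : Represents G P :=
  fun u v huv => (h u v huv).trans edges_inter_nonempty

theorem Represents.flip (h : Represents G P) : Represents G fun v => (P v).flip :=
  fun u v huv => (h u v huv).trans meets_flip.symm

theorem Represents.meets (h : Represents G P) (hK : G.IsClique K) {u v : V} (hu : u ∈ K)
    (hv : v ∈ K) : (P u).Meets (P v) := by
  rcases eq_or_ne u v with rfl | huv
  · exact meets_self _
  · exact (h u v huv).1 (hK hu hv huv)

/-- This is the only way in which maximality of a clique is used: it draws a blocking path into the
clique. -/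
theorem Represents.mem (h : Represents G P) (hK : IsMaxClique G K) {w : V}
    (hw : ∀ v ∈ K, (P w).Meets (P v)) : w ∈ K := by
  have : G.IsClique (insert w K) :=
    hK.prop.insert fun v hv hwv => (h w v hwv).2 (hw v hv)
  exact hK.le_of_ge this (Set.subset_insert w K) (Set.mem_insert w K)

/-- All paths of `K` contain a common horizontal edge. -/
def RowEdge (P : V → GridPath) (K : Set V) : Prop :=
  ∃ c i, ∀ v ∈ K, (P v).y = c ∧ (P v).lo ≤ i ∧ i < (P v).hi

/-- The path runs straight from the left to the right through the point `(a, c)`. -/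
def GridPath.Through (a c : ℤ) (p : GridPath) : Prop := p.y = c ∧ p.lo < a ∧ a < p.hi

/-- The path has a bend at `(a, c)`, upwards if `0 < d`, and downwards otherwise. -/
def GridPath.BendsAt (a c d : ℤ) (p : GridPath) : Prop :=
  p.x = a ∧ p.y = c ∧ p.x' ≠ a ∧ ((0 < d ∧ c < p.y') ∨ (d ≤ 0 ∧ p.y' < c))

/-- The paths of `K` contain at least two of three edges at a point: the two horizontal ones and
one of the vertical ones; and not all of them contain the same edge. -/
def RowClaw (P : V → GridPath) (K : Set V) : Prop :=
  ∃ a c d, (∀ v ∈ K, (P v).Through a c ∨ (P v).BendsAt a c d) ∧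
    (∃ v ∈ K, (P v).Through a c) ∧ (∃ v ∈ K, (P v).BendsAt a c d ∧ (P v).x' < a) ∧
    ∃ v ∈ K, (P v).BendsAt a c d ∧ a < (P v).x'

/-- If all horizontal parts overlap pairwise, the edge at the largest left end is common, by the
Helly property. Otherwise two of them share only a column edge, so they come from opposite sides to
a common bend and turn the same way. Any other path meets both, hence runs straight through this
point or bends there likewise. If none runs straight through, the vertical edge at the bend is
common to all. -/
theorem rowEdge_or_rowClaw [Finite V] (hne : K.Nonempty)
    (hK : ∀ u ∈ K, ∀ v ∈ K, (P u).Meets (P v)) {c : ℤ}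
    (hrow : ∀ v ∈ K, (P v).y = c ∧ (P v).lo < (P v).hi) :
    RowEdge P K ∨ RowClaw P K ∨ RowEdge (fun v => (P v).flip) K := by
  by_cases h : ∀ u ∈ K, ∀ v ∈ K, (P u).RowShare (P v)
  · obtain ⟨v, hv, hmax⟩ := Set.exists_max_image K (fun v => (P v).lo) K.toFinite hne
    exact Or.inl ⟨c, (P v).lo, fun u hu => ⟨(hrow u hu).1, hmax u hu, (h u hu v hv).2.2.2.2⟩⟩
  right
  push Not at h
  obtain ⟨u, hu, v, hv, huv⟩ := h
  wlog hlt : (P u).x' < (P v).x' generalizing u v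
  · refine this v hv u hu (fun h => huv h.symm) ?_
    have h₁ := hrow u hu; have h₂ := hrow v hv; have := hK u hu v hv
    simp only [Meets, RowShare, lo, hi, GridPath.flip] at *; omega
  have hup : ∃ d : ℤ, (P u).BendsAt (P u).x c d ∧ (P v).BendsAt (P u).x c d := by
    -- Only the sign of `d` matters; this choice is positive exactly if `u` turns upwards.
    refine ⟨(P u).y' - c, ?_⟩
    have h₁ := hrow u hu; have h₂ := hrow v hv; have := hK u hu v hv
    simp only [Meets, RowShare, lo, hi, GridPath.flip, BendsAt, true_and] at *; omega
  obtain ⟨d, hbu, hbv⟩ := hup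
  have hxx : (P u).x' < (P u).x ∧ (P u).x < (P v).x' := by
    have h₁ := hrow u hu; have h₂ := hrow v hv
    simp only [RowShare, lo, hi, BendsAt] at *; omega
  have hall : ∀ w ∈ K, (P w).Through (P u).x c ∨ (P w).BendsAt (P u).x c d := by
    intro w hw
    have h₀ := hrow w hw; have h₁ := hK w hw u hu; have h₂ := hK w hw v hv
    simp only [Meets, RowShare, lo, hi, GridPath.flip, BendsAt, Through] at *; omega
  by_cases hthr : ∃ w ∈ K, (P w).Through (P u).x c
  · exact Or.inl ⟨_, c, d, hall, hthr, ⟨u, hu, hbu, hxx.1⟩, v, hv, hbv, hxx.2⟩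
  · right
    push Not at hthr
    by_cases hd : 0 < d
    · refine ⟨(P u).x, c, fun w hw => ?_⟩
      have := (hall w hw).resolve_left (hthr w hw)
      simp only [lo, hi, GridPath.flip, BendsAt] at *; omega
    -- Edges are named by their lower end, so the one below the bend has number `c - 1`.
    · refine ⟨(P u).x, c - 1, fun w hw => ?_⟩
      have := (hall w hw).resolve_left (hthr w hw)
      simp only [lo, hi, GridPath.flip, BendsAt] at *; omega

/-- If the paths do not all have horizontal parts in one row, some two of them meet only in a
column. A further path cannot meet both of these in rows, since that would put both into the same
row; so all paths have vertical parts in that column. -/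
theorem clique_cases [Finite V] (hne : K.Nonempty)
    (hK : ∀ u ∈ K, ∀ v ∈ K, (P u).Meets (P v)) :
    RowEdge P K ∨ RowEdge (fun v => (P v).flip) K ∨ RowClaw P K ∨
      RowClaw (fun v => (P v).flip) K := by
  have hrow : (∃ c, ∀ v ∈ K, (P v).y = c ∧ (P v).lo < (P v).hi) ∨
      ∃ c, ∀ v ∈ K, (P v).flip.y = c ∧ (P v).flip.lo < (P v).flip.hi := by
    by_cases h : ∀ u ∈ K, ∀ v ∈ K,
        (P u).y = (P v).y ∧ (P u).lo < (P u).hi ∧ (P v).lo < (P v).hi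
    · obtain ⟨u, hu⟩ := hne
      exact Or.inl ⟨(P u).y, fun v hv => ⟨(h v hv u hu).1, (h v hv u hu).2.1⟩⟩
    · push Not at h
      obtain ⟨u, hu, v, hv, huv⟩ := h
      refine Or.inr ⟨(P u).x, fun w hw => ?_⟩
      have h₁ := hK u hu v hv; have h₂ := hK w hw u hu; have h₃ := hK w hw v hv
      simp only [Meets, RowShare, lo, hi, GridPath.flip] at *; omega
  rcases hrow with ⟨c, h⟩ | ⟨c, h⟩
  · have := rowEdge_or_rowClaw hne hK h; tauto
  · have := rowEdge_or_rowClaw (P := fun v => (P v).flip) hne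
      (fun u hu v hv => meets_flip.2 (hK u hu v hv)) h
    exact this.elim (fun h => Or.inr (Or.inl h)) fun h => h.elim (fun h => Or.inr (Or.inr (Or.inr h)))
      fun h => Or.inl h

end Cliques

/-! ### Kernels of acyclic relations -/

/-- `S` is a kernel of the relation `B`. -/
def IsKernel {V : Type*} (B : V → V → Prop) (S : V → Prop) : Prop :=
  ∀ v, S v ↔ ∀ w, B w v → ¬ S w

theorem exists_isKernel {V : Type*} {B : V → V → Prop} (h : WellFounded B) :
    ∃ S, IsKernel B S :=
  ⟨h.fix fun v ih => ∀ w (hw : B w v), ¬ ih w hw, fun v => by rw [h.fix_eq]⟩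

/-! ### Selections along the rows as kernels of blocking relations -/

section Blocking

variable {V : Type*} [LinearOrder V] {G : SimpleGraph V} {P : V → GridPath} {K : Set V}
  {ex : V → Prop} {extra : V → V → Prop} {S : V → Prop}

/-- Some horizontal part that starts further to the left contains the first edge of the horizontal
part of `v`. -/
def EarlierThan (P : V → GridPath) (z v : V) : Prop :=
  (P z).y = (P v).y ∧ (P z).lo < (P v).lo ∧ (P v).lo < (P z).hi ∧ (P v).lo < (P v).hi

/-- The relation of which the selected set of vertices is a kernel. -/
def Blocks (P : V → GridPath) (ex : V → Prop) (extra : V → V → Prop) (w v : V) : Prop :=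
  extra w v ∨ ((P w).y = (P v).y ∧ (P v).lo < (P v).hi ∧ (P v).lo < (P w).hi ∧
    ((P w).lo < (P v).lo ∨ ((P w).lo = (P v).lo ∧
      (((P w).typ < (P v).typ ∧ ¬ ((P w).typ = 0 ∧ (P v).typ = 1 ∧ ex v)) ∨
        ((P w).typ = (P v).typ ∧ w < v)))))

/-- The condition that is imposed on the additional part of the blocking relation. -/
def Tame (P : V → GridPath) (extra : V → V → Prop) : Prop :=
  ∀ w v, extra w v → (P v).typ = 0 ∧ (P w).x = (P v).x ∧ (P w).y = (P v).y ∧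
    (P w).x' < (P w).x ∧ (P w).y < (P w).y'

theorem wellFounded_blocks [Finite V] (hx : Tame P extra) : WellFounded (Blocks P ex extra) := by
  let key : V → ℤ ×ₗ ℤ ×ₗ V := fun v => toLex ((P v).lo, toLex ((P v).typ, v))
  have : WellFounded fun w v => key w < key v := by
    have h₁ : IsTrans V fun w v => key w < key v := ⟨fun _ _ _ => lt_trans⟩
    have h₂ : Std.Irrefl fun w v => key w < key v := ⟨fun _ => lt_irrefl _⟩
    exact Finite.wellFounded_of_trans_of_irrefl _
  refine Subrelation.wf (fun {w v} h => ?_) this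
  simp only [key, Prod.Lex.toLex_lt_toLex]
  rcases h with h | h
  -- By tameness the horizontal part of `w` ends on the right at the bend where that of `v` starts,
  -- so `w` has the smaller left end.
  · have := hx w v h
    rw [typ_eq_zero] at this
    left; simp only [lo]; omega
  · tauto

theorem Blocks.rowShare {w v : V} (h : Blocks P ex extra w v) (h' : ¬ extra w v) :
    (P w).RowShare (P v) := by
  rcases h with h | h
  · exact absurd h h'
  · unfold RowShare; omega

/-- Of two overlapping horizontal parts, the one that comes first in the order contains the first
edge of the other. It blocks the other unless the exception applies, and a kernel contains no
blocking pair. -/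
theorem IsKernel.pair (hS : IsKernel (Blocks P ex extra) S) {u v : V} (hu : S u) (hv : S v)
    (huv : u ≠ v) (h : (P u).RowShare (P v)) : (P u).lo = (P v).lo ∧
      (((P u).typ = 0 ∧ (P v).typ = 1 ∧ ex v) ∨ ((P v).typ = 0 ∧ (P u).typ = 1 ∧ ex u)) := by
  wlog huv' : (P u).lo < (P v).lo ∨ (P u).lo = (P v).lo ∧ ((P u).typ < (P v).typ ∨
      (P u).typ = (P v).typ ∧ u < v) generalizing u v
  · have := this hv hu huv.symm h.symm (by
      rcases lt_or_gt_of_ne huv with h' | h' <;> simp only [h', and_true] at huv' ⊢ <;> omega)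
    exact ⟨this.1.symm, this.2.symm⟩
  have hB : ¬ Blocks P ex extra u v := fun h => (hS v).1 hv u h hu
  obtain ⟨ha, hb, hc, hd, he⟩ := h
  rcases huv' with hl | ⟨hl, ht | ht⟩
  · exact absurd (Or.inr ⟨ha, hc, he, Or.inl hl⟩) hB
  · by_cases hex : (P u).typ = 0 ∧ (P v).typ = 1 ∧ ex v
    · exact ⟨hl, Or.inl hex⟩
    · exact absurd (Or.inr ⟨ha, hc, he, Or.inr ⟨hl, Or.inl ⟨ht, hex⟩⟩⟩) hB
  · exact absurd (Or.inr ⟨ha, hc, he, Or.inr ⟨hl, Or.inr ht⟩⟩) hB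

variable (hG : Represents G P) (hK : IsMaxClique G K) (hS : IsKernel (Blocks P ex extra) S)
  (hex : ∀ v, ex v → ∃ z, EarlierThan P z v) (hx : Tame P extra)

include hG hK hS hex in
-- Two selected members would be an exceptional pair, and all left ends in the clique would agree.
-- The path from further left that justifies the exception then contains the first edge of every
-- member, so it belongs to the clique, although its left end differs.
theorem RowEdge.not_all (hE : RowEdge P K) (hnt : K.Nontrivial) : ¬ ∀ v ∈ K, S v := by
  intro hall
  obtain ⟨c, i, hE⟩ := hE
  have key : ∀ u ∈ K, ∀ v ∈ K, u ≠ v → (P u).lo = (P v).lo ∧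
      (((P u).typ = 0 ∧ (P v).typ = 1 ∧ ex v) ∨ ((P v).typ = 0 ∧ (P u).typ = 1 ∧ ex u)) := by
    intro u hu v hv huv
    refine hS.pair (hall u hu) (hall v hv) huv ?_
    have := hE u hu; have := hE v hv
    unfold RowShare; omega
  have step : ∀ u ∈ K, ∀ v ∈ K, u ≠ v → (P u).typ = 0 → ex v → False := by
    intro u hu v hv huv h0 hv'
    obtain ⟨z, hz⟩ := hex v hv'
    have hzK : z ∈ K := by
      refine hG.mem hK fun w hw => Or.inl ?_
      have h₁ : (P w).lo = (P v).lo := by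
        rcases eq_or_ne w v with rfl | hwv
        · rfl
        · exact (key w hw v hv hwv).1
      have h₂ := hE w hw; have h₃ := hE v hv
      unfold EarlierThan at hz; unfold RowShare; omega
    have := (key z hzK v hv (by rintro rfl; exact absurd hz.2.1 (lt_irrefl _))).1
    exact absurd hz.2.1 (by omega)
  obtain ⟨u, hu, v, hv, huv⟩ := hnt
  rcases (key u hu v hv huv).2 with h | h
  · exact step u hu v hv huv h.1 h.2.2
  · exact step v hv u hu huv.symm h.1 h.2.2

include hG hK hS hx in
-- The first edge of a member that starts furthest to the right lies in all members. A selected path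
-- that blocks it meets all of them, and so belongs to the clique.
theorem RowEdge.not_none [Finite V] (hE : RowEdge P K) (hnt : K.Nonempty) :
    ¬ ∀ v ∈ K, ¬ S v := by
  intro hnone
  obtain ⟨c, i, hE⟩ := hE
  -- The type breaks ties because of `extra`: if such a blocker acts on `v`, then `v` has type 0,
  -- and so has every member with the same left end. These members meet the blocker in the vertical
  -- edge above the bend; members starting further left meet it in the edge before the bend.
  obtain ⟨v, hv, hmax⟩ := Set.exists_max_image K (fun v => toLex ((P v).lo, (P v).typ))
    K.toFinite hnt
  simp only [Prod.Lex.toLex_le_toLex] at hmax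
  have hSv := hnone v hv
  rw [hS v] at hSv
  push Not at hSv
  obtain ⟨w, hB, hw⟩ := hSv
  refine hnone w (hG.mem hK fun k hk => ?_) hw
  have h₁ := hE k hk; have h₂ := hE v hv; have h₃ := hmax k hk
  by_cases h : extra w v
  · obtain ⟨h0, h4⟩ := hx w v h
    rcases lt_or_eq_of_le (show (P k).lo ≤ (P v).lo by omega) with hlt | heq
    · left
      rw [typ_eq_zero] at h0
      simp only [RowShare, lo, hi] at *; omega
    · right
      have : (P k).typ = 0 := by have := typ_cases (P k); omega
      rw [typ_eq_zero] at h0 this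
      simp only [RowShare, lo, hi, GridPath.flip] at *; omega
  · have := hB.rowShare h
    left; unfold RowShare at *
    rcases hB with hB | hB <;> [exact absurd hB h; omega]

include hS in
-- The straight path and the path that bends at its right end share a row edge, but a path with its
-- bend at the right end has type 2, and so is in no exceptional pair.
theorem RowClaw.not_all (hC : RowClaw P K) : ¬ ∀ v ∈ K, S v := by
  intro hall
  obtain ⟨a, c, d, -, ⟨z, hz, hz'⟩, ⟨b, hb, hb'⟩, -⟩ := hC
  have hshare : (P z).RowShare (P b) := by
    simp only [Through, BendsAt, RowShare, lo, hi] at *; omega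
  have := (hS.pair (hall z hz) (hall b hb)
    (by rintro rfl; simp only [Through, BendsAt, lo, hi] at *; omega) hshare).2
  simp only [typ_eq_zero, typ_eq_one, BendsAt] at this hb'
  omega

include hG hK hS hx in
-- Consider the member `v` that bends at its left end. A selected blocker that ran through the
-- centre of the claw, or bent there in the direction of the claw, would belong to the clique. So it
-- bends there in the opposite direction: it has type 0, `v` has type 1, and the exception was not
-- made for `v`, although the straight member starts further left.
theorem RowClaw.exists_of_none (hC : RowClaw P K) (hnone : ∀ v ∈ K, ¬ S v) :
    ∃ v ∈ K, ∃ b ∈ K, v ≠ b ∧ (P v).typ = 1 ∧ (∃ z, EarlierThan P z v) ∧ ¬ ex v ∧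
      (P v).flip.RowShare (P b).flip := by
  obtain ⟨a, c, d, hall, ⟨z, hz, hz'⟩, ⟨b, hb, hb', hba⟩, v, hv, hv', hva⟩ := hC
  have hmem : ∀ w, ((P w).Through a c ∨ (P w).BendsAt a c d) → w ∈ K := by
    intro w hw
    refine hG.mem hK fun k hk => ?_
    have := hall k hk
    simp only [Meets, Through, BendsAt, RowShare, lo, hi, GridPath.flip] at *; omega
  have hSv := hnone v hv
  rw [hS v] at hSv
  push Not at hSv
  obtain ⟨w, hB, hw⟩ := hSv
  have hwK : ¬ ((P w).Through a c ∨ (P w).BendsAt a c d) := fun h => hnone w (hmem w h) hw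
  have hearly : EarlierThan P z v := by
    simp only [EarlierThan, Through, BendsAt, lo, hi] at *; omega
  rcases hB with hB | ⟨h₁, h₂, h₃, h₄⟩
  · refine absurd (Or.inr ?_) hwK
    have := hx w v hB
    rw [typ_eq_zero] at this
    simp only [BendsAt] at *; omega
  have hlo : (P v).lo = a := by simp only [BendsAt, lo] at *; omega
  rcases h₄ with h₄ | ⟨h₄, h₅⟩
  · refine absurd (Or.inl ?_) hwK
    simp only [Through, BendsAt] at *; omega
  have hwv : (P w).typ ≠ (P v).typ := by
    intro h
    have h6 := typ_cases (P v)
    have h7 := typ_eq_zero (p := P v); have h8 := typ_eq_one (p := P v)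
    rw [← h] at h6 h7 h8
    rw [typ_eq_zero] at h7; rw [typ_eq_one] at h8
    simp only [Through, BendsAt, lo] at *; omega
  have hlt : (P w).typ < (P v).typ ∧ ¬ ((P w).typ = 0 ∧ (P v).typ = 1 ∧ ex v) := by tauto
  have hv2 : (P v).typ ≠ 2 := by
    have h6 := typ_cases (P v)
    have h7 := typ_eq_zero (p := P v); have h8 := typ_eq_one (p := P v)
    simp only [BendsAt] at *; omega
  have hv1 : (P w).typ = 0 ∧ (P v).typ = 1 := by
    have := typ_cases (P v); have := typ_cases (P w); omega
  refine ⟨v, hv, b, hb, by rintro rfl; omega, hv1.2, ⟨z, hearly⟩,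
    fun h => hlt.2 ⟨hv1.1, hv1.2, h⟩, ?_⟩
  simp only [BendsAt, RowShare, lo, hi, GridPath.flip] at *; omega

end Blocking

/-! ### Combining the row and column selections into four colors -/

section Coloring

variable {V : Type*} [LinearOrder V] {G : SimpleGraph V} {P : V → GridPath} {H W : V → Prop}

/-- The relation that selects vertices in the rows. -/
def RowBlocks (P : V → GridPath) : V → V → Prop :=
  Blocks P (fun v => ∃ z, EarlierThan P z v) fun _ _ => False

/-- The exceptions in the columns, when the vertices `H` have been selected in the rows. -/
def ColEx (P : V → GridPath) (H : V → Prop) (v : V) : Prop :=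
  ∃ z, EarlierThan (fun v => (P v).flip) z v ∧ ¬ H v

/-- The additional blocking relation in the columns. -/
def ColExtra (P : V → GridPath) (H : V → Prop) (w v : V) : Prop :=
  (P w).typ = 1 ∧ (P v).flip.typ = 0 ∧ (P w).x = (P v).x ∧ (P w).y = (P v).y ∧ H w

/-- The relation that selects vertices in the columns. -/
def ColBlocks (P : V → GridPath) (H : V → Prop) : V → V → Prop :=
  Blocks (fun v => (P v).flip) (ColEx P H) (ColExtra P H)

omit [LinearOrder V] in
theorem tame_colExtra : Tame (fun v => (P v).flip) (ColExtra P H) := by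
  rintro w v ⟨h₁, h₂, h₃, h₄, -⟩
  rw [typ_eq_one] at h₁
  exact ⟨h₂, h₄, h₃, h₁.2, h₁.1⟩

theorem wellFounded_rowBlocks [Finite V] : WellFounded (RowBlocks P) :=
  wellFounded_blocks fun _ _ h => h.elim

theorem wellFounded_colBlocks [Finite V] : WellFounded (ColBlocks P H) :=
  wellFounded_blocks tame_colExtra

/-- Only a column claw with no vertex in `W` needs both selections. An exception was missing there
although an earlier path exists, so `v` is in `H`, and by homogeneity so is `b`. Both use the
horizontal leg of the claw, but `v` goes left from its bend and so has type 2, contrary to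
`IsKernel.pair`. -/
theorem not_monochromatic [Finite V] (hG : Represents G P) (hH : IsKernel (RowBlocks P) H)
    (hW : IsKernel (ColBlocks P H) W) {K : Set V} (hK : IsMaxClique G K) (hnt : K.Nontrivial) :
    ¬ (((∀ v ∈ K, H v) ∨ ∀ v ∈ K, ¬ H v) ∧ ((∀ v ∈ K, W v) ∨ ∀ v ∈ K, ¬ W v)) := by
  have hx : Tame P fun _ _ => False := fun _ _ h => h.elim
  rintro ⟨h₁, h₂⟩
  rcases clique_cases hnt.nonempty (fun u hu v hv => hG.meets hK.prop hu hv) with h | h | h | h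
  · rcases h₁ with h₁ | h₁
    · exact h.not_all hG hK hH (fun v hv => hv) hnt h₁
    · exact h.not_none hG hK hH hx hnt.nonempty h₁
  · rcases h₂ with h₂ | h₂
    · exact h.not_all hG.flip hK hW (fun v ⟨z, hz, _⟩ => ⟨z, hz⟩) hnt h₂
    · exact h.not_none hG.flip hK hW tame_colExtra hnt.nonempty h₂
  · rcases h₁ with h₁ | h₁
    · exact h.not_all hH h₁
    · obtain ⟨v, -, b, -, -, -, he, hne, -⟩ := h.exists_of_none hG hK hH hx h₁
      exact hne he
  · rcases h₂ with h₂ | h₂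
    · exact h.not_all hW h₂
    · obtain ⟨v, hv, b, hb, hvb, ht, ⟨z, hz⟩, hne, hs⟩ :=
        h.exists_of_none hG.flip hK hW tame_colExtra h₂
      have hHv : H v := by
        by_contra hHv
        exact hne ⟨z, hz, hHv⟩
      have hHb : H b := by
        rcases h₁ with h₁ | h₁
        · exact h₁ b hb
        · exact absurd hHv (h₁ v hv)
      have := (hH.pair hHv hHb hvb hs).2
      simp only [typ_eq_zero, typ_eq_one, GridPath.flip] at this ht
      omega

/-- A common row edge would make an exceptional row pair, in which the vertex of type 1 blocks the
other in the columns through `ColExtra`. A common column edge would require an exception in the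
columns, which is granted only outside `H`. -/
theorem not_adj_of_selected (hG : Represents G P) (hH : IsKernel (RowBlocks P) H)
    (hW : IsKernel (ColBlocks P H) W) {u v : V} (hu : H u ∧ W u) (hv : H v ∧ W v) :
    ¬ G.Adj u v := by
  intro huv
  rcases (hG u v huv.ne).1 huv with h | h
  · have hp := hH.pair hu.1 hv.1 huv.ne h
    wlog hr : (P u).typ = 0 ∧ (P v).typ = 1 generalizing u v
    · refine this hv hu huv.symm h.symm ⟨hp.1.symm, hp.2.symm⟩ ?_
      have := hp.2
      tauto
    refine (hW u).1 hu.2 v (Or.inl ⟨hr.2, ?_, ?_, h.1.symm, hv.1⟩) hv.2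
    · rw [typ_eq_zero] at hr ⊢
      exact ⟨hr.1.2, hr.1.1⟩
    · have := hp.1
      rw [typ_eq_zero, typ_eq_one] at hr
      simp only [lo] at this; omega
  · rcases (hW.pair hu.2 hv.2 huv.ne h).2 with ⟨-, -, z, -, h⟩ | ⟨-, -, z, -, h⟩
    · exact h hv.1
    · exact h hu.1

open Classical in
/-- The color of a vertex, determined by the two selections. -/
noncomputable def selectionColor (H W : V → Prop) (v : V) : Fin 4 :=
  if H v then (if W v then 3 else 2) else (if W v then 1 else 0)

theorem isCliqueColoring_selectionColor [Finite V] (hG : Represents G P)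
    (hH : IsKernel (RowBlocks P) H) (hW : IsKernel (ColBlocks P H) W) :
    IsCliqueColoring G (selectionColor H W) := by
  rintro K hK hnt ⟨c, hc⟩
  obtain ⟨u, hu⟩ := hnt.nonempty
  have key : ∀ v ∈ K, (H v ↔ H u) ∧ (W v ↔ W u) := by
    intro v hv
    have := (hc v hv).trans (hc u hu).symm
    unfold selectionColor at this
    by_cases h₁ : H v <;> by_cases h₂ : W v <;> by_cases h₃ : H u <;> by_cases h₄ : W u <;>
      simp [h₁, h₂, h₃, h₄] at this ⊢
  refine not_monochromatic hG hH hW hK hnt ⟨?_, ?_⟩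
  · by_cases h : H u
    · exact Or.inl fun v hv => (key v hv).1.2 h
    · exact Or.inr fun v hv h' => h ((key v hv).1.1 h')
  · by_cases h : W u
    · exact Or.inl fun v hv => (key v hv).2.2 h
    · exact Or.inr fun v hv h' => h ((key v hv).2.1 h')

theorem isIndepSet_selectionColor (hG : Represents G P)
    (hH : IsKernel (RowBlocks P) H) (hW : IsKernel (ColBlocks P H) W) :
    G.IsIndepSet {v | selectionColor H W v = 3} := by
  have key : ∀ v, selectionColor H W v = 3 → H v ∧ W v := by
    intro v hv
    unfold selectionColor at hv
    by_cases h₁ : H v <;> by_cases h₂ : W v <;> simp [h₁, h₂] at hv ⊢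
  exact fun u hu v hv _ => not_adj_of_selected hG hH hW (key u hu) (key v hv)

end Coloring

theorem IsB1EPG.cliqueColorable {V : Type*} [Finite V] {G : SimpleGraph V} (h : IsB1EPG G) :
    CliqueColorable G 4 := by
  obtain ⟨P, hP⟩ := h
  obtain ⟨n, ⟨e⟩⟩ := Finite.exists_equiv_fin V
  -- Any linear order will do; it only breaks ties between equal left ends and types.
  let _ : LinearOrder V := LinearOrder.lift' e e.injective
  obtain ⟨H, hH⟩ := exists_isKernel (wellFounded_rowBlocks (P := P))
  obtain ⟨W, hW⟩ := exists_isKernel (wellFounded_colBlocks (P := P) (H := H))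
  exact ⟨_, isCliqueColoring_selectionColor hP.represents hH hW⟩

/-! ### Reasoning about programs -/

namespace RAM

/-- The state `s` after writing `x` into cell `i` of array `a`. -/
def State.write (s : State) (a : ℕ) (i x : ℤ) : State :=
  Function.update s a (Function.update (s a) i x)

theorem State.write_apply (s : State) (a : ℕ) (i x : ℤ) (b : ℕ) (j : ℤ) :
    s.write a i x b j = if b = a ∧ j = i then x else s b j := by
  unfold State.write
  by_cases h : b = a
  · subst h; by_cases h' : j = i <;> simp [h']
  · simp [h]

theorem State.write_of_ne (s : State) (a : ℕ) (i x : ℤ) {b : ℕ} (h : b ≠ a) :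
    s.write a i x b = s b := by
  simp [State.write, h]

/-- The program contains no loop. -/
def Program.LoopFree : Program → Prop
  | .skip => True
  | .assign _ _ _ => True
  | .seq c₁ c₂ => c₁.LoopFree ∧ c₂.LoopFree
  | .branch _ c₁ c₂ => c₁.LoopFree ∧ c₂.LoopFree
  | .loop _ _ => False

open Classical in
/-- The effect of a loop-free program. -/
noncomputable def Program.eff : Program → State → State
  | .skip, s => s
  | .assign a e₁ e₂, s => s.write a (e₁.eval s) (e₂.eval s)
  | .seq c₁ c₂, s => c₂.eff (c₁.eff s)
  | .branch b c₁ c₂, s => if b.Holds s then c₁.eff s else c₂.eff s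
  | .loop _ _, s => s

/-- A bound for the time that is needed if every loop body is executed at most once. -/
def Program.bound : Program → ℕ
  | .skip => 1
  | .assign _ e₁ e₂ => e₁.cost + e₂.cost + 1
  | .seq c₁ c₂ => c₁.bound + c₂.bound
  | .branch b c₁ c₂ => b.cost + max c₁.bound c₂.bound + 1
  | .loop b c => b.cost + c.bound + 1

/-- The program writes into the array `a`. -/
def Program.Writes (a : ℕ) : Program → Prop
  | .skip => False
  | .assign b _ _ => a = b
  | .seq c₁ c₂ => c₁.Writes a ∨ c₂.Writes a
  | .branch _ c₁ c₂ => c₁.Writes a ∨ c₂.Writes a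
  | .loop _ c => c.Writes a

theorem Program.LoopFree.exec {c : Program} (h : c.LoopFree) (s : State) :
    ∃ t ≤ c.bound, Exec c s t (c.eff s) := by
  induction c generalizing s with
  | skip => exact ⟨1, le_rfl, .skip s⟩
  | assign a e₁ e₂ => exact ⟨_, le_rfl, .assign s a e₁ e₂⟩
  | seq c₁ c₂ ih₁ ih₂ =>
    obtain ⟨t₁, h₁, e₁⟩ := ih₁ h.1 s
    obtain ⟨t₂, h₂, e₂⟩ := ih₂ h.2 (c₁.eff s)
    exact ⟨_, add_le_add h₁ h₂, .seq e₁ e₂⟩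
  | branch b c₁ c₂ ih₁ ih₂ =>
    by_cases hb : b.Holds s
    · obtain ⟨t, h₁, e⟩ := ih₁ h.1 s
      refine ⟨b.cost + t + 1, ?_, ?_⟩
      · simp only [Program.bound]; omega
      · rw [Program.eff, if_pos hb]; exact .branch_true hb e
    · obtain ⟨t, h₁, e⟩ := ih₂ h.2 s
      refine ⟨b.cost + t + 1, ?_, ?_⟩
      · simp only [Program.bound]; omega
      · rw [Program.eff, if_neg hb]; exact .branch_false hb e
  | loop b c ih => exact h.elim

theorem Exec.eq_of_not_writes {c : Program} {s s' : State} {t : ℕ} (h : Exec c s t s') {a : ℕ}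
    (ha : ¬ c.Writes a) : s' a = s a := by
  induction h with
  | skip s => rfl
  | assign s b e₁ e₂ => exact State.write_of_ne s b _ _ ha
  | seq _ _ ih₁ ih₂ => exact (ih₂ fun h => ha (.inr h)).trans (ih₁ fun h => ha (.inl h))
  | branch_true _ _ ih => exact ih fun h => ha (.inl h)
  | branch_false _ _ ih => exact ih fun h => ha (.inr h)
  | loop_done _ => rfl
  | loop_step _ _ _ ih₁ ih₂ => exact (ih₂ ha).trans (ih₁ ha)

theorem Program.eff_eq_of_not_writes {c : Program} (s : State) {a : ℕ} (ha : ¬ c.Writes a) :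
    c.eff s a = s a := by
  induction c generalizing s with
  | skip => rfl
  | assign b e₁ e₂ => exact State.write_of_ne s b _ _ ha
  | seq c₁ c₂ ih₁ ih₂ => exact (ih₂ _ fun h => ha (.inr h)).trans (ih₁ _ fun h => ha (.inl h))
  | branch b c₁ c₂ ih₁ ih₂ =>
    rw [Program.eff]
    split_ifs
    · exact ih₁ _ fun h => ha (.inl h)
    · exact ih₂ _ fun h => ha (.inr h)
  | loop b c ih => rfl

/-- Started in `s`, the program `c` halts in a state with property `Q`, in time linear in `N`; and
it changes only the arrays into which it writes. -/
def Runs (c : Program) (s : State) (N : ℕ) (Q : State → Prop) : Prop :=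
  ∃ t s', Exec c s t s' ∧ t ≤ c.bound * (N + 1) ∧ Q s'

theorem Runs.mono {c : Program} {s : State} {N : ℕ} {Q Q' : State → Prop} (h : Runs c s N Q)
    (hQ : ∀ s', (∀ a, ¬ c.Writes a → s' a = s a) → Q s' → Q' s') : Runs c s N Q' := by
  obtain ⟨t, s', h₁, h₂, h₃⟩ := h
  exact ⟨t, s', h₁, h₂, hQ s' (fun a ha => h₁.eq_of_not_writes ha) h₃⟩

/-- `Program.bound` is additive over sequences, so the constant of the final time bound can be read
off the program text. -/
theorem Runs.seq {c₁ c₂ : Program} {s : State} {N : ℕ} {Q : State → Prop}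
    (h : Runs c₁ s N fun s' => Runs c₂ s' N Q) : Runs (.seq c₁ c₂) s N Q := by
  obtain ⟨t₁, s₁, e₁, h₁, t₂, s₂, e₂, h₂, hQ⟩ := h
  refine ⟨_, s₂, .seq e₁ e₂, ?_, hQ⟩
  rw [Program.bound, add_mul]
  exact add_le_add h₁ h₂

/-- The index of the invariant is a decreasing measure, which bounds the number of rounds. Each
round costs at most a constant because the body contains no loop. -/
theorem Runs.loop {b : Test} {c : Program} (hc : c.LoopFree) {I : ℕ → State → Prop}
    (hstep : ∀ k s, I k s → b.Holds s → ∃ l < k, I l (c.eff s)) {s : State} {k N : ℕ}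
    (hs : I k s) (hN : k ≤ N) : Runs (.loop b c) s N fun s' => (∃ l, I l s') ∧ ¬ b.Holds s' := by
  induction N generalizing s k with
  | zero =>
    by_cases hb : b.Holds s
    · obtain ⟨l, hl, -⟩ := hstep k s hs hb; omega
    · exact ⟨_, s, .loop_done hb, by rw [Program.bound]; omega, ⟨k, hs⟩, hb⟩
  | succ N ih =>
    by_cases hb : b.Holds s
    · obtain ⟨l, h₁, h₂⟩ := hstep k s hs hb
      obtain ⟨t₁, h₃, e₁⟩ := hc.exec s
      obtain ⟨t₂, s', e₂, h₄, h₅, h₆⟩ := ih h₂ (by omega)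
      refine ⟨_, s', .loop_step hb e₁ e₂, ?_, h₅, h₆⟩
      rw [mul_add_one]
      rw [Program.bound] at *
      omega
    · refine ⟨_, s, .loop_done hb, ?_, ⟨k, hs⟩, hb⟩
      have := Nat.le_mul_of_pos_right (b.cost + c.bound + 1) (Nat.succ_pos (N + 1))
      rw [Nat.succ_eq_add_one] at this
      rw [Program.bound]
      omega

/-- The content of the cell `0` of the array `a`. -/
abbrev Expr.reg (a : ℕ) : Expr := .get a (.lit 0)

/-- The loop that executes `c` with the values `0, …, e - 1` of the cell `0` of the array `a`. -/
def Program.count (a : ℕ) (e : Expr) (c : Program) : Program :=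
  .loop (.not (.le e (.reg a))) (.seq c (.assign a (.lit 0) (.add (.reg a) (.lit 1))))

/-- The measure is the number of remaining rounds. The limit is evaluated anew in each round, so it
must depend only on arrays that the loop leaves alone, and the invariant must survive changes of the
counter. -/
theorem Runs.count {a : ℕ} {e : Expr} {c : Program} (hc : c.LoopFree) (ha : ¬ c.Writes a)
    {I : ℕ → State → Prop} {m N : ℕ} {s : State}
    (he : ∀ s', (∀ a', a' ≠ a → ¬ c.Writes a' → s' a' = s a') → e.eval s' = m)
    (hmN : m ≤ N) (hI : ∀ k s' i x, I k s' → I k (s'.write a i x))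
    (hstep : ∀ k < m, ∀ s', (∀ a', a' ≠ a → ¬ c.Writes a' → s' a' = s a') → s' a 0 = (k : ℤ) →
      I k s' → I (k + 1) (c.eff s'))
    (hs : s a 0 = 0) (h0 : I 0 s) : Runs (Program.count a e c) s N (I m) := by
  have := Runs.loop (b := .not (.le e (.reg a)))
    (c := .seq c (.assign a (.lit 0) (.add (.reg a) (.lit 1))))
    (I := fun l s' => ∃ k ≤ m, l = m - k ∧ s' a 0 = (k : ℤ) ∧ I k s' ∧
      ∀ a', a' ≠ a → ¬ c.Writes a' → s' a' = s a') ⟨hc, trivial⟩ ?_ (s := s) (k := m)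
    ⟨0, Nat.zero_le _, rfl, by simpa using hs, h0, fun _ _ _ => rfl⟩ hmN
  · refine this.mono ?_
    rintro s' - ⟨⟨l, k, hk, -, hk', hI', hf⟩, h⟩
    simp only [Test.Holds, he s' hf, Expr.eval, hk', not_not] at h
    obtain rfl : k = m := by omega
    exact hI'
  · rintro l s' ⟨k, hk, rfl, hk', hI', hf⟩ h
    simp only [Test.Holds, he s' hf, Expr.eval, hk'] at h
    have h' : c.eff s' a = s' a := Program.eff_eq_of_not_writes _ ha
    refine ⟨m - (k + 1), by omega, k + 1, by omega, rfl, ?_, ?_, ?_⟩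
    · simp [Program.eff, Expr.eval, State.write_apply, h', hk']
    · exact hI _ _ _ _ (hstep k (by omega) s' hf hk' hI')
    · intro a' h₁ h₂
      rw [Program.eff, Program.eff, State.write_of_ne _ _ _ _ h₁,
        Program.eff_eq_of_not_writes _ h₂, hf a' h₁ h₂]

end RAM

/-! ### Marking the ends of edges -/

namespace RAM

section Phases

variable {n : ℕ} {E : List (Fin n × Fin n)} {T : Expr → Expr → Test} {R : Fin n → Fin n → Prop}

/-- The memory holds the number of vertices and the list of edges. -/
def Loaded (E : List (Fin n × Fin n)) (s : State) : Prop :=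
  s 0 0 = n ∧ s 0 1 = E.length ∧
    ∀ (e : ℕ) (h : e < E.length), s 5 e = ((E[e].1 : ℕ) : ℤ) ∧ s 6 e = ((E[e].2 : ℕ) : ℤ)

theorem Loaded.congr {s s' : State} (h : Loaded E s) (hs : ∀ a < 7, s' a = s a) :
    Loaded E s' := by
  unfold Loaded
  rwa [hs 0 (by omega), hs 5 (by omega), hs 6 (by omega)]

/-- The test `T` decides the relation `R`, and depends only on the arrays below `k`. -/
def Decides (T : Expr → Expr → Test) (R : Fin n → Fin n → Prop) (k : ℕ) (s : State) : Prop :=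
  ∀ s' : State, (∀ a < k, s' a = s a) → ∀ e₁ e₂ (u v : Fin n), e₁.eval s' = ((u : ℕ) : ℤ) →
    e₂.eval s' = ((v : ℕ) : ℤ) → ((T e₁ e₂).Holds s' ↔ R u v)

/-- Marks in the array `a` the vertices `v` for which there is an edge `uv` with `T u v`. -/
def markEnds (T : Expr → Expr → Test) (a : ℕ) : Program :=
  .count (a + 1) (.get 0 (.lit 1))
    (.seq (.branch (T (.get 5 (.reg (a + 1))) (.get 6 (.reg (a + 1))))
        (.assign a (.get 6 (.reg (a + 1))) (.lit 1)) .skip)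
      (.branch (T (.get 6 (.reg (a + 1))) (.get 5 (.reg (a + 1))))
        (.assign a (.get 5 (.reg (a + 1))) (.lit 1)) .skip))

theorem writes_markEnds {a c : ℕ} : (markEnds T a).Writes c ↔ c = a ∨ c = a + 1 := by
  simp [markEnds, Program.count, Program.Writes]

theorem runs_markEnds {a k N : ℕ} {s : State} (hk : k ≤ a) (ha : 7 ≤ a) (hE : Loaded E s)
    (hT : Decides T R k s) (hN : E.length ≤ N) (h₀ : s a = 0) (h₁ : s (a + 1) = 0) :
    Runs (markEnds T a) s N fun s' =>
      ∀ v : Fin n, s' a (v : ℕ) = 1 ↔ ∃ u, ((u, v) ∈ E ∨ (v, u) ∈ E) ∧ R u v := by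
  classical
  have := Runs.count (a := a + 1) (e := .get 0 (.lit 1))
    (c := .seq (.branch (T (.get 5 (.reg (a + 1))) (.get 6 (.reg (a + 1))))
        (.assign a (.get 6 (.reg (a + 1))) (.lit 1)) .skip)
      (.branch (T (.get 6 (.reg (a + 1))) (.get 5 (.reg (a + 1))))
        (.assign a (.get 5 (.reg (a + 1))) (.lit 1)) .skip))
    (I := fun i s' => ∀ v : Fin n, s' a (v : ℕ) = 1 ↔
      ∃ u, ((u, v) ∈ E.take i ∨ (v, u) ∈ E.take i) ∧ R u v) (m := E.length) (s := s)
    (by simp [Program.LoopFree]) (by simp [Program.Writes]) ?_ hN ?_ ?_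
    (by simp [h₁]) (by simp [h₀])
  · simpa [markEnds] using this
  · intro s' hs'
    simp only [Expr.eval]
    rw [hs' 0 (by omega) (by simp [Program.Writes]; omega), hE.2.1]
  · intro i s' j x h
    rwa [State.write_of_ne _ _ _ _ (by omega)]
  · intro i hi s' hs' hi' hI v
    have hfr : ∀ c, c < a → s' c = s c := fun c hc =>
      hs' c (by omega) (by simp [Program.Writes]; omega)
    obtain ⟨h5, h6⟩ := hE.2.2 i hi
    rw [← hfr 5 (by omega)] at h5
    rw [← hfr 6 (by omega)] at h6
    rw [List.take_succ_eq_append_getElem hi]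
    rcases hpq : E[i] with ⟨p, q⟩
    simp only [hpq] at h5 h6
    -- The statement allows a state other than `s'`, since the second branch runs after the first
    -- may have marked a vertex.
    have hb : ∀ s₁ : State, (∀ c, c < a → s₁ c = s' c) → s₁ (a + 1) = s' (a + 1) →
        ∀ x y : Fin n, ∀ r₁ r₂ : ℕ, r₁ < 7 → r₂ < 7 → s' r₁ i = ((x : ℕ) : ℤ) →
          s' r₂ i = ((y : ℕ) : ℤ) →
        Program.eff (.branch (T (.get r₁ (.reg (a + 1))) (.get r₂ (.reg (a + 1))))
          (.assign a (.get r₂ (.reg (a + 1))) (.lit 1)) .skip) s₁ =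
          if R x y then s₁.write a (y : ℕ) 1 else s₁ := by
      intro s₁ h₁ h₂ x y r₁ r₂ hr₁ hr₂ hx hy
      rw [← h₁ r₁ (by omega)] at hx
      rw [← h₁ r₂ (by omega)] at hy
      have ht := hT s₁ (fun c hc => by rw [h₁ c (by omega), hfr c (by omega)])
        (.get r₁ (.reg (a + 1))) (.get r₂ (.reg (a + 1))) x y (by simp [Expr.eval, h₂, hi', hx])
        (by simp [Expr.eval, h₂, hi', hy])
      by_cases hR : R x y <;> simp only [Program.eff, ht, Expr.eval, h₂, hi', hy, hR, if_true, if_false]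
    rw [Program.eff, hb s' (fun _ _ => rfl) rfl p q 5 6 (by omega) (by omega) h5 h6,
      hb _ (fun c hc => by split_ifs; exacts [State.write_of_ne _ _ _ _ (by omega), rfl])
        (by split_ifs; exacts [State.write_of_ne _ _ _ _ (by omega), rfl]) q p 6 5 (by omega)
        (by omega) h6 h5]
    have hv : ∀ w : Fin n, ((v : ℕ) : ℤ) = ((w : ℕ) : ℤ) ↔ v = w := fun w => by
      rw [Nat.cast_inj, Fin.val_inj]
    have hval : (if R q p then (if R p q then s'.write a (q : ℕ) 1 else s').write a (p : ℕ) 1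
        else if R p q then s'.write a (q : ℕ) 1 else s') a (v : ℕ) = 1 ↔
        (R q p ∧ v = p) ∨ (R p q ∧ v = q) ∨ s' a (v : ℕ) = 1 := by
      by_cases hR₁ : R p q <;> by_cases hR₂ : R q p <;>
        simp only [hR₁, hR₂, State.write_apply, hv, if_true, if_false, true_and, false_and,
          false_or] <;> split_ifs <;> simp [*]
    rw [hval, hI v]
    simp only [List.mem_append, List.mem_singleton, Prod.mk.injEq]
    constructor
    · rintro (⟨h, rfl⟩ | ⟨h, rfl⟩ | ⟨u, h, h'⟩)
      · exact ⟨q, by simp, h⟩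
      · exact ⟨p, by simp, h⟩
      · exact ⟨u, h.imp Or.inl Or.inl, h'⟩
    · rintro ⟨u, (h | ⟨rfl, rfl⟩) | (h | ⟨rfl, rfl⟩), h'⟩
      · exact Or.inr (Or.inr ⟨u, Or.inl h, h'⟩)
      · exact Or.inr (Or.inl ⟨h', rfl⟩)
      · exact Or.inr (Or.inr ⟨u, Or.inr h, h'⟩)
      · exact Or.inl ⟨h', rfl⟩

end Phases

end RAM

/-! ### Computing the kernel of an acyclic relation on the edges of a graph -/

namespace RAM

section KernelProgram

variable {n : ℕ} {E : List (Fin n × Fin n)} {T : Expr → Expr → Test} {R : Fin n → Fin n → Prop}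

theorem cast_val_inj {u v : Fin n} : ((u : ℕ) : ℤ) = ((v : ℕ) : ℤ) ↔ u = v := by
  rw [Nat.cast_inj, Fin.val_inj]

/-- The arc `i`, that is, the edge `i - 1` if it is related by `R`, leads from `u` to `v`. -/
def Arc (E : List (Fin n × Fin n)) (R : Fin n → Fin n → Prop) (i : ℕ) (u v : Fin n) : Prop :=
  1 ≤ i ∧ (E[i - 1]? = some (u, v) ∨ E[i - 1]? = some (v, u)) ∧ R u v

/-- Among the arcs with numbers at most `k` the last one that leaves `u` has number `j`, where `0`
means that there is none. -/
def IsLast (E : List (Fin n × Fin n)) (R : Fin n → Fin n → Prop) (u : Fin n) (k j : ℕ) : Prop :=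
  j ≤ k ∧ (j = 0 ∨ ∃ v, Arc E R j u v) ∧ ∀ i v, j < i → i ≤ k → ¬ Arc E R i u v

theorem Arc.le_length {i : ℕ} {u v : Fin n} (h : Arc E R i u v) : i ≤ E.length := by
  obtain ⟨h₁, h₂, -⟩ := h
  have : i - 1 < E.length := by
    rcases h₂ with h | h <;> exact (List.getElem?_eq_some_iff.1 h).1
  omega

/-- By asymmetry an edge carries an arc in at most one direction, so the number of the edge
identifies the arc. -/
theorem Arc.unique (hR : ∀ u v, R u v → ¬ R v u) {i : ℕ} {u v u' v' : Fin n}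
    (h : Arc E R i u v) (h' : Arc E R i u' v') : u = u' ∧ v = v' := by
  obtain ⟨-, h₁, h₂⟩ := h
  obtain ⟨-, h₃, h₄⟩ := h'
  rcases h₁ with h₁ | h₁ <;> rcases h₃ with h₃ | h₃ <;>
    simp only [h₁, Option.some.injEq, Prod.mk.injEq] at h₃ <;> obtain ⟨rfl, rfl⟩ := h₃
  · exact ⟨rfl, rfl⟩
  · exact absurd h₄ (hR _ _ h₂)
  · exact absurd h₄ (hR _ _ h₂)
  · exact ⟨rfl, rfl⟩

theorem exists_arc {u v : Fin n} (h : (u, v) ∈ E ∨ (v, u) ∈ E) (hR : R u v) :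
    ∃ i, Arc E R i u v := by
  rcases h with h | h <;> obtain ⟨i, hi⟩ := List.mem_iff_getElem?.1 h
  · exact ⟨i + 1, by omega, Or.inl (by simpa using hi), hR⟩
  · exact ⟨i + 1, by omega, Or.inr (by simpa using hi), hR⟩

/-- The arcs are stored in linked lists: array `b` holds for each vertex its last outgoing arc,
array `b + 1` the previous arc with the same source, and array `b + 2` the target of an arc. -/
def Linked (E : List (Fin n × Fin n)) (R : Fin n → Fin n → Prop) (b k : ℕ) (s : State) : Prop :=
  (∀ u : Fin n, ∃ j : ℕ, s b (u : ℕ) = (j : ℤ) ∧ IsLast E R u k j) ∧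
    ∀ i u v, i ≤ k → Arc E R i u v → s (b + 2) (i : ℤ) = ((v : ℕ) : ℤ) ∧
      ∃ j : ℕ, s (b + 1) (i : ℤ) = (j : ℤ) ∧ IsLast E R u (i - 1) j

open Classical in
/-- The array `b + 3` holds the numbers of ingoing arcs among the arcs in `D`. -/
def Counted (E : List (Fin n × Fin n)) (R : Fin n → Fin n → Prop) (b : ℕ) (D : Finset ℕ)
    (s : State) : Prop :=
  ∀ v : Fin n, s (b + 3) (v : ℕ) = ((D.filter fun i => ∃ u, Arc E R i u v).card : ℤ)

theorem Linked.congr {b k : ℕ} {s s' : State} (h : Linked E R b k s)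
    (hs : ∀ c < b + 3, s' c = s c) : Linked E R b k s' := by
  unfold Linked
  rwa [hs b (by omega), hs (b + 1) (by omega), hs (b + 2) (by omega)]

theorem Counted.congr {b : ℕ} {D : Finset ℕ} {s s' : State} (h : Counted E R b D s)
    (hs : s' (b + 3) = s (b + 3)) : Counted E R b D s' := by
  unfold Counted
  rwa [hs]

/-- Stores the edge with the number in the cell `0` of array `b + 6` as an arc, from the end that
is stored in array `r₁` to the end that is stored in array `r₂`. -/
def link (b r₁ r₂ : ℕ) : Program :=
  .seq (.assign (b + 1) (.add (.reg (b + 6)) (.lit 1)) (.get b (.get r₁ (.reg (b + 6)))))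
    (.seq (.assign b (.get r₁ (.reg (b + 6))) (.add (.reg (b + 6)) (.lit 1)))
      (.seq (.assign (b + 2) (.add (.reg (b + 6)) (.lit 1)) (.get r₂ (.reg (b + 6))))
        (.assign (b + 3) (.get r₂ (.reg (b + 6)))
          (.add (.get (b + 3) (.get r₂ (.reg (b + 6)))) (.lit 1)))))

theorem eff_link {b r₁ r₂ k : ℕ} {s : State} {p q : Fin n} (h₁ : r₁ < b) (h₂ : r₂ < b)
    (hk : s (b + 6) 0 = (k : ℤ)) (hp : s r₁ k = ((p : ℕ) : ℤ)) (hq : s r₂ k = ((q : ℕ) : ℤ)) :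
    (link b r₁ r₂).eff s =
      (((s.write (b + 1) (k + 1) (s b (p : ℕ))).write b (p : ℕ) (k + 1)).write (b + 2) (k + 1)
        (q : ℕ)).write (b + 3) (q : ℕ) (s (b + 3) (q : ℕ) + 1) := by
  have a₁ : r₁ ≠ b ∧ r₁ ≠ b + 1 ∧ r₁ ≠ b + 2 := by omega
  have a₂ : r₂ ≠ b ∧ r₂ ≠ b + 1 ∧ r₂ ≠ b + 2 := by omega
  simp [link, Program.eff, Expr.eval, State.write_apply, hk, hp, hq, a₁, a₂]

/-- The new arc becomes the head of the list of its source, and the old head becomes its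
predecessor; all other lists are unchanged. -/
theorem Linked.link (hR : ∀ u v, R u v → ¬ R v u) {b k : ℕ} {s : State} {p q : Fin n}
    (h : Linked E R b k s) (hpq : Arc E R (k + 1) p q) : Linked E R b (k + 1)
      ((((s.write (b + 1) (k + 1) (s b (p : ℕ))).write b (p : ℕ) (k + 1)).write (b + 2) (k + 1)
        (q : ℕ)).write (b + 3) (q : ℕ) (s (b + 3) (q : ℕ) + 1)) := by
  obtain ⟨h₁, h₂⟩ := h
  constructor
  · intro u
    simp only [State.write_apply, cast_val_inj]
    by_cases hu : u = p
    · subst hu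
      exact ⟨k + 1, by simp, le_rfl, Or.inr ⟨q, hpq⟩, fun i v h h' => by omega⟩
    · obtain ⟨j, hj, hj₁, hj₂, hj₃⟩ := h₁ u
      refine ⟨j, by simp [hu, hj], by omega, hj₂, fun i v hi hi' ha => ?_⟩
      rcases Nat.lt_or_ge k i with h | h
      · obtain rfl : i = k + 1 := by omega
        exact hu (ha.unique hR hpq).1
      · exact hj₃ i v hi h ha
  · intro i u v hi ha
    simp only [State.write_apply]
    rcases Nat.lt_or_ge k i with h | h
    · obtain rfl : i = k + 1 := by omega
      obtain ⟨rfl, rfl⟩ := ha.unique hR hpq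
      obtain ⟨j, hj, hj'⟩ := h₁ u
      exact ⟨by simp, j, by simp [hj], by simpa using hj'⟩
    · have hne : ¬ (i : ℤ) = (k : ℤ) + 1 := by omega
      simpa [hne] using h₂ i u v h ha

theorem Linked.skip {b k : ℕ} {s : State} (h : Linked E R b k s)
    (hk : ∀ u v, ¬ Arc E R (k + 1) u v) : Linked E R b (k + 1) s := by
  refine ⟨fun u => ?_, fun i u v hi ha => ?_⟩
  · obtain ⟨j, hj, hj₁, hj₂, hj₃⟩ := h.1 u
    refine ⟨j, hj, by omega, hj₂, fun i v hi hi' ha => ?_⟩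
    rcases Nat.lt_or_ge k i with h | h
    · obtain rfl : i = k + 1 := by omega
      exact hk u v ha
    · exact hj₃ i v hi h ha
  · rcases Nat.lt_or_ge k i with h' | h'
    · obtain rfl : i = k + 1 := by omega
      exact absurd ha (hk u v)
    · exact h.2 i u v h' ha

theorem Counted.link (hR : ∀ u v, R u v → ¬ R v u) {b k : ℕ} {s : State} {p q : Fin n} {x y : ℤ}
    (h : Counted E R b (Finset.range (k + 1)) s) (hpq : Arc E R (k + 1) p q) :
    Counted E R b (Finset.range (k + 1 + 1))
      ((((s.write (b + 1) x y).write b (p : ℕ) x).write (b + 2) x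
        (q : ℕ)).write (b + 3) (q : ℕ) (s (b + 3) (q : ℕ) + 1)) := by
  intro v
  rw [Finset.range_add_one, Finset.filter_insert]
  by_cases hv : v = q
  · subst hv
    rw [if_pos ⟨p, hpq⟩, Finset.card_insert_of_notMem (by simp), Nat.cast_add, ← h v]
    simp [State.write_apply]
  · rw [if_neg (fun ⟨u, hu⟩ => hv (hu.unique hR hpq).2), ← h v]
    have hv' : (v : ℕ) ≠ q := fun h => hv (Fin.ext h)
    simp [State.write_apply, hv']

theorem Counted.skip {b k : ℕ} {s : State} (h : Counted E R b (Finset.range (k + 1)) s)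
    (hk : ∀ u v, ¬ Arc E R (k + 1) u v) : Counted E R b (Finset.range (k + 1 + 1)) s := by
  intro v
  rw [Finset.range_add_one, Finset.filter_insert, if_neg (fun ⟨u, hu⟩ => hk u v hu), h v]

/-- Stores an edge as an arc if its ends are related by `T`. -/
def storeEdge (T : Expr → Expr → Test) (b : ℕ) : Program :=
  .branch (T (.get 5 (.reg (b + 6))) (.get 6 (.reg (b + 6)))) (link b 5 6)
    (.branch (T (.get 6 (.reg (b + 6))) (.get 5 (.reg (b + 6)))) (link b 6 5) .skip)

/-- Builds the linked lists of arcs and counts the arcs that enter the vertices. -/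
def storeArcs (T : Expr → Expr → Test) (b : ℕ) : Program :=
  .count (b + 6) (.get 0 (.lit 1)) (storeEdge T b)

theorem writes_storeArcs {b c : ℕ} (h : (storeArcs T b).Writes c) :
    b ≤ c ∧ c ≤ b + 3 ∨ c = b + 6 := by
  simp only [storeArcs, storeEdge, link, Program.count, Program.Writes, or_false] at h
  omega

theorem runs_storeArcs (hR : ∀ u v, R u v → ¬ R v u) {b N : ℕ} {s : State} (hb : 7 ≤ b)
    (hE : Loaded E s) (hT : Decides T R b s) (hN : E.length ≤ N) (h₀ : ∀ c, b ≤ c → s c = 0) :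
    Runs (storeArcs T b) s N fun s' =>
      Linked E R b E.length s' ∧ Counted E R b (Finset.range (E.length + 1)) s' := by
  classical
  have hw : ∀ c, (storeEdge T b).Writes c → b ≤ c ∧ c ≤ b + 3 := by
    intro c h
    simp only [storeEdge, link, Program.Writes, or_false] at h
    omega
  refine Runs.count (I := fun k s' =>
      Linked E R b k s' ∧ Counted E R b (Finset.range (k + 1)) s')
    (by simp [storeEdge, link, Program.LoopFree]) (fun h => by have := hw _ h; omega) ?_ hN ?_ ?_
    (by simp [h₀]) ⟨⟨fun u => ?_, fun i u v hi ha => ?_⟩, fun v => ?_⟩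
  · intro s' hs'
    rw [Expr.eval, hs' 0 (by omega) (fun h => by have := hw _ h; omega)]
    exact hE.2.1
  · rintro i s' j x ⟨h₁, h₂⟩
    exact ⟨h₁.congr fun c hc => State.write_of_ne _ _ _ _ (by omega),
      h₂.congr (State.write_of_ne _ _ _ _ (by omega))⟩
  · rintro k hk s' hs' hk' ⟨hL, hC⟩
    have hfr : ∀ c, c < b → s' c = s c := fun c hc =>
      hs' c (by omega) (fun h => by have := hw _ h; omega)
    obtain ⟨h5, h6⟩ := hE.2.2 k hk
    rw [← hfr 5 (by omega)] at h5
    rw [← hfr 6 (by omega)] at h6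
    rcases hpq : E[k] with ⟨p, q⟩
    have hpq' : E[k]? = some (p, q) := by rw [List.getElem?_eq_getElem hk, hpq]
    simp only [hpq] at h5 h6
    have ht₁ := hT s' (fun c hc => hfr c (by omega)) (.get 5 (.reg (b + 6)))
      (.get 6 (.reg (b + 6))) p q (by simp [Expr.eval, hk', h5]) (by simp [Expr.eval, hk', h6])
    have ht₂ := hT s' (fun c hc => hfr c (by omega)) (.get 6 (.reg (b + 6)))
      (.get 5 (.reg (b + 6))) q p (by simp [Expr.eval, hk', h6]) (by simp [Expr.eval, hk', h5])
    rw [storeEdge, Program.eff]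
    split_ifs with h
    · have ha : Arc E R (k + 1) p q := ⟨by omega, Or.inl hpq', ht₁.1 h⟩
      rw [eff_link (by omega) (by omega) hk' h5 h6]
      exact ⟨hL.link hR ha, hC.link hR ha⟩
    · rw [Program.eff]
      split_ifs with h'
      · have ha : Arc E R (k + 1) q p := ⟨by omega, Or.inr hpq', ht₂.1 h'⟩
        rw [eff_link (by omega) (by omega) hk' h6 h5]
        exact ⟨hL.link hR ha, hC.link hR ha⟩
      · have ha : ∀ u v, ¬ Arc E R (k + 1) u v := by
          rintro u v ⟨-, h₁, h₂⟩
          simp only [Nat.add_sub_cancel, hpq', Option.some.injEq, Prod.mk.injEq] at h₁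
          rcases h₁ with ⟨rfl, rfl⟩ | ⟨rfl, rfl⟩
          · exact h (ht₁.2 h₂)
          · exact h' (ht₂.2 h₂)
        exact ⟨hL.skip ha, hC.skip ha⟩
  -- Arcs are numbered from 1, so the initial zeros already represent empty lists.
  · exact ⟨0, by simp [h₀], le_rfl, Or.inl rfl, fun i v h h' => by omega⟩
  · have := ha.1; omega
  · rw [h₀ _ (by omega), Finset.filter_false_of_mem]
    · simp
    · rintro i hi ⟨u, ha⟩
      have := ha.1
      simp at hi; omega

/-- The cell `j` of the array of registers of the queue. -/
abbrev qreg (b : ℕ) (j : ℤ) : Expr := .get (b + 8) (.lit j)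

/-- Array `b + 4` holds the list `q`, whose length is stored in the cell `0` of array `b + 8`. -/
def IsQueue (b : ℕ) (q : List (Fin n)) (s : State) : Prop :=
  q.Nodup ∧ s (b + 8) 0 = (q.length : ℤ) ∧
    ∀ (i : ℕ) (h : i < q.length), s (b + 4) (i : ℤ) = ((q[i] : ℕ) : ℤ)

theorem IsQueue.congr {b : ℕ} {q : List (Fin n)} {s s' : State} (h : IsQueue b q s)
    (h₁ : s' (b + 8) 0 = s (b + 8) 0) (h₂ : s' (b + 4) = s (b + 4)) : IsQueue b q s' := by
  unfold IsQueue
  rwa [h₁, h₂]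

theorem IsQueue.push {b : ℕ} {q : List (Fin n)} {s s' : State} (h : IsQueue b q s) {v : Fin n}
    (hv : v ∉ q) (h₁ : s' (b + 8) 0 = s (b + 8) 0 + 1)
    (h₂ : ∀ x, s' (b + 4) x = if x = s (b + 8) 0 then ((v : ℕ) : ℤ) else s (b + 4) x) :
    IsQueue b (q ++ [v]) s' := by
  obtain ⟨h₃, h₄, h₅⟩ := h
  refine ⟨?_, by simp [h₁, h₄], fun i hi => ?_⟩
  · rw [List.nodup_append]
    exact ⟨h₃, by simp, by rintro a ha b hb rfl; simp at hb; exact hv (hb ▸ ha)⟩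
  · rw [h₂, h₄]
    simp only [Nat.cast_inj]
    by_cases h : i = q.length
    · simp [h]
    · have : i < q.length := by simp at hi; omega
      rw [if_neg h, h₅ i this, List.getElem_append_left this]

/-- Puts a vertex into the queue if it has no ingoing arcs. -/
def initStep (b : ℕ) : Program :=
  .branch (.eq (.get (b + 3) (.reg (b + 7))) (.lit 0))
    (.seq (.assign (b + 4) (qreg b 0) (.reg (b + 7)))
      (.assign (b + 8) (.lit 0) (.add (qreg b 0) (.lit 1)))) .skip

/-- Puts the vertices without ingoing arcs into the queue. -/
def initQueue (b : ℕ) : Program := .count (b + 7) (.get 0 (.lit 0)) (initStep b)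

theorem writes_initQueue {b c : ℕ} (h : (initQueue b).Writes c) :
    c = b + 4 ∨ c = b + 7 ∨ c = b + 8 := by
  simp only [initQueue, initStep, Program.count, Program.Writes, or_false] at h
  omega

/-- The claim about the other registers starts the traversal with no vertex removed from the queue
and no current arc. -/
theorem runs_initQueue {b N : ℕ} {s : State} (hn : s 0 0 = (n : ℤ)) (hN : n ≤ N)
    (h₄ : s (b + 7) = 0) (h₈ : s (b + 8) = 0) :
    Runs (initQueue b) s N fun s' => (∃ q : List (Fin n), IsQueue b q s' ∧
      ∀ v : Fin n, v ∈ q ↔ s (b + 3) (v : ℕ) = 0) ∧ ∀ j ≠ 0, s' (b + 8) j = 0 := by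
  have := Runs.count (a := b + 7) (e := .get 0 (.lit 0)) (c := initStep b)
    (I := fun k s' => (∃ q : List (Fin n), IsQueue b q s' ∧
      ∀ v : Fin n, v ∈ q ↔ (v : ℕ) < k ∧ s (b + 3) (v : ℕ) = 0) ∧ ∀ j ≠ 0, s' (b + 8) j = 0)
    (s := s) (m := n) (by simp [initStep, Program.LoopFree])
    (by simp [initStep, Program.Writes]) ?_ hN ?_ ?_
    (by simp [h₄]) ⟨⟨[], ⟨by simp, by simp [h₈], by simp⟩, by simp⟩, by simp [h₈]⟩
  · simpa [initQueue] using this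
  · intro s' hs'
    rw [Expr.eval, hs' 0 (by omega) (by simp [initStep, Program.Writes])]
    exact hn
  · rintro k s' i x ⟨⟨q, hq, h⟩, hj⟩
    rw [State.write_of_ne _ _ _ _ (by omega)]
    exact ⟨⟨q, hq.congr (by rw [State.write_of_ne _ _ _ _ (by omega)])
      (State.write_of_ne _ _ _ _ (by omega)), h⟩, hj⟩
  · rintro k hk s' hs' hk' ⟨⟨q, hq, h⟩, hj⟩
    have hd : s' (b + 3) = s (b + 3) := hs' _ (by omega) (by simp [initStep, Program.Writes])
    by_cases h0 : s (b + 3) (k : ℤ) = 0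
    · have heff : (initStep b).eff s' =
          (s'.write (b + 4) (s' (b + 8) 0) k).write (b + 8) 0 (s' (b + 8) 0 + 1) := by
        simp [initStep, Program.eff, Test.Holds, Expr.eval, hk', hd, h0, State.write_apply]
      rw [heff]
      refine ⟨⟨q ++ [⟨k, hk⟩], hq.push (fun hm => ?_) ?_ fun x => ?_, fun v => ?_⟩, fun j hj' => ?_⟩
      · have := ((h _).1 hm).1
        simp at this
      · simp [State.write_apply]
      · simp [State.write_apply]
      · rw [List.mem_append, h, List.mem_singleton, Fin.ext_iff]
        constructor
        · rintro (h | h)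
          · exact ⟨by omega, h.2⟩
          · exact ⟨by simp only at h; omega, by rw [h]; exact h0⟩
        · rintro ⟨h₁, h₂⟩
          rcases Nat.lt_or_ge (v : ℕ) k with h | h
          · exact Or.inl ⟨h, h₂⟩
          · exact Or.inr (by simp only; omega)
      · simp [State.write_apply, hj', hj]
    · have heff : (initStep b).eff s' = s' := by
        simp [initStep, Program.eff, Test.Holds, Expr.eval, hk', hd, h0]
      rw [heff]
      refine ⟨⟨q, hq, fun v => ?_⟩, hj⟩
      rw [h]
      constructor
      · exact fun h => ⟨by omega, h.2⟩
      · rintro ⟨h₁, h₂⟩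
        refine ⟨?_, h₂⟩
        by_contra h₃
        have : (v : ℕ) = k := by omega
        rw [this] at h₂
        exact h0 h₂

end KernelProgram

end RAM

/-! ### The traversal in topological order and its invariant -/

namespace RAM

section KernelLoop

variable {n : ℕ} {E : List (Fin n × Fin n)} {T : Expr → Expr → Test} {R : Fin n → Fin n → Prop}
  {S : Fin n → Prop} {b : ℕ}

/-- Takes the next vertex from the queue and turns to its last outgoing arc. -/
def popVertex (b : ℕ) : Program :=
  .seq (.assign (b + 8) (.lit 3) (.get (b + 4) (qreg b 1)))
    (.seq (.assign (b + 8) (.lit 1) (.add (qreg b 1) (.lit 1)))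
      (.assign (b + 8) (.lit 2) (.get b (qreg b 3))))

/-- Processes the current arc: if its source is selected, its target becomes blocked; and if it is
the last arc that enters its target, this vertex is put into the queue. -/
def followArc (b : ℕ) : Program :=
  .seq (.branch (.eq (.get (b + 5) (qreg b 3)) (.lit 0))
      (.assign (b + 5) (.get (b + 2) (qreg b 2)) (.lit 1)) .skip)
    (.seq (.assign (b + 3) (.get (b + 2) (qreg b 2))
        (.sub (.get (b + 3) (.get (b + 2) (qreg b 2))) (.lit 1)))
      (.seq (.branch (.eq (.get (b + 3) (.get (b + 2) (qreg b 2))) (.lit 0))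
          (.seq (.assign (b + 4) (qreg b 0) (.get (b + 2) (qreg b 2)))
            (.assign (b + 8) (.lit 0) (.add (qreg b 0) (.lit 1)))) .skip)
        (.assign (b + 8) (.lit 2) (.get (b + 1) (qreg b 2)))))

/-- Visits the vertices in topological order. -/
def visitAll (b : ℕ) : Program :=
  .loop (.not (.and (.eq (qreg b 2) (.lit 0)) (.eq (qreg b 0) (qreg b 1))))
    (.branch (.eq (qreg b 2) (.lit 0)) (popVertex b) (followArc b))

theorem writes_visitAll {c : ℕ} (h : (visitAll b).Writes c) :
    c = b + 3 ∨ c = b + 4 ∨ c = b + 5 ∨ c = b + 8 := by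
  simp only [visitAll, popVertex, followArc, Program.Writes, or_false] at h
  omega

theorem eff_popVertex {s : State} : (popVertex b).eff s =
    ((s.write (b + 8) 3 (s (b + 4) (s (b + 8) 1))).write (b + 8) 1 (s (b + 8) 1 + 1)).write
      (b + 8) 2 (s b (s (b + 4) (s (b + 8) 1))) := by
  simp [popVertex, Program.eff, Expr.eval, State.write_apply]

theorem eff_followArc (s : State) {v : ℤ} (hv : s (b + 2) (s (b + 8) 2) = v) :
    (∀ x, (followArc b).eff s (b + 5) x =
      if x = v ∧ s (b + 5) (s (b + 8) 3) = 0 then 1 else s (b + 5) x) ∧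
    (∀ x, (followArc b).eff s (b + 3) x = if x = v then s (b + 3) v - 1 else s (b + 3) x) ∧
    (∀ x, (followArc b).eff s (b + 4) x =
      if x = s (b + 8) 0 ∧ s (b + 3) v = 1 then v else s (b + 4) x) ∧
    (followArc b).eff s (b + 8) 0 = (if s (b + 3) v = 1 then s (b + 8) 0 + 1 else s (b + 8) 0) ∧
    (followArc b).eff s (b + 8) 1 = s (b + 8) 1 ∧
    (followArc b).eff s (b + 8) 2 = s (b + 1) (s (b + 8) 2) ∧
    (followArc b).eff s (b + 8) 3 = s (b + 8) 3 := by
  by_cases h₁ : s (b + 5) (s (b + 8) 3) = 0 <;> by_cases h₂ : s (b + 3) v = 1 <;>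
    simp [followArc, Program.eff, Test.Holds, Expr.eval, State.write_apply, hv, h₁, h₂, sub_eq_zero]

/-- The state of the topological search: `q` is the list of all vertices that have been put into
the queue, `h` of which have been removed; and the arcs in `D` have not been followed. -/
structure Visiting (E : List (Fin n × Fin n)) (R : Fin n → Fin n → Prop) (S : Fin n → Prop)
    (b : ℕ) (q : List (Fin n)) (h p : ℕ) (D : Finset ℕ) (s : State) : Prop where
  linked : Linked E R b E.length s
  queue : IsQueue b q s
  le_length : h ≤ q.length
  head : s (b + 8) 1 = (h : ℤ)
  arc : s (b + 8) 2 = (p : ℤ)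
  mem_iff : ∀ i, i ∈ D ↔ ∃ u v, Arc E R i u v ∧
    (u ∉ q.take h ∨ ((u : ℕ) : ℤ) = s (b + 8) 3 ∧ i ≤ p)
  counted : Counted E R b D s
  mem_queue : ∀ v : Fin n, v ∈ q ↔ s (b + 3) (v : ℕ) = 0
  free : ∀ v : Fin n, s (b + 5) (v : ℕ) = 0 ↔ ∀ i u, Arc E R i u v → i ∉ D → ¬ S u
  source : p ≠ 0 → ∃ u v, Arc E R p u v ∧ ((u : ℕ) : ℤ) = s (b + 8) 3 ∧ u ∈ q.take h

variable {q : List (Fin n)} {h p : ℕ} {D : Finset ℕ} {s : State}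

theorem Visiting.notMem (hV : Visiting E R S b q h p D s) {v : Fin n} (hv : v ∈ q) {i : ℕ}
    {u : Fin n} (ha : Arc E R i u v) : i ∉ D := by
  classical
  intro hi
  have := (hV.mem_queue v).1 hv
  rw [hV.counted v, Nat.cast_eq_zero, Finset.card_eq_zero] at this
  exact (Finset.eq_empty_iff_forall_notMem.1 this) i (Finset.mem_filter.2 ⟨hi, u, ha⟩)

/-- All arcs into a queued vertex have been followed, so its flag already accounts for every vertex
that could block it and is final. -/
theorem Visiting.free_iff (hV : Visiting E R S b q h p D s) (hS : IsKernel R S)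
    (hE : ∀ u v, R u v → (u, v) ∈ E ∨ (v, u) ∈ E) {v : Fin n} (hv : v ∈ q) :
    s (b + 5) (v : ℕ) = 0 ↔ S v := by
  rw [hV.free, hS v]
  constructor
  · intro h w hw
    obtain ⟨i, hi⟩ := exists_arc (hE w v hw) hw
    exact h i w hi (hV.notMem hv hi)
  · exact fun h i u ha _ => h u ha.2.2

/-- No arc is followed here: those leaving the removed vertex are exactly the ones in the list that
now becomes current, so `D` stays the same. -/
theorem Visiting.pop (hV : Visiting E R S b q h 0 D s) (hlt : h < q.length) :
    ∃ p', Visiting E R S b q (h + 1) p' D ((popVertex b).eff s) := by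
  obtain ⟨j, hj, hj₁, hj₂, hj₃⟩ := hV.linked.1 q[h]
  have hqh : s (b + 4) (h : ℤ) = ((q[h] : ℕ) : ℤ) := hV.queue.2.2 h hlt
  have heff : (popVertex b).eff s = ((s.write (b + 8) 3 (q[h] : ℕ)).write (b + 8) 1
      (h + 1)).write (b + 8) 2 j := by
    rw [eff_popVertex, hV.head, hqh, hj]
  have hne : ∀ c, c ≠ b + 8 → (popVertex b).eff s c = s c := fun c hc => by
    rw [heff, State.write_of_ne _ _ _ _ hc, State.write_of_ne _ _ _ _ hc,
      State.write_of_ne _ _ _ _ hc]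
  have hmem : ∀ u, u ∈ q.take (h + 1) ↔ u ∈ q.take h ∨ u = q[h] := fun u => by
    rw [List.take_succ_eq_append_getElem hlt, List.mem_append, List.mem_singleton]
  have hnot : q[h] ∉ q.take h := by
    have := hV.queue.1.sublist (List.take_sublist (h + 1) q)
    rw [List.take_succ_eq_append_getElem hlt, List.nodup_append] at this
    exact fun hm => this.2.2 _ hm _ (List.mem_singleton_self _) rfl
  refine ⟨j, hV.linked.congr fun c hc => hne c (by omega), hV.queue.congr ?_ (hne _ (by omega)),
    hlt, ?_, ?_, fun i => ?_, hV.counted.congr (hne _ (by omega)), fun v => ?_, fun v => ?_,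
    fun hj0 => ?_⟩
  · simp [heff, State.write_apply]
  · simp [heff, State.write_apply]
  · simp [heff, State.write_apply]
  · have h3 : (popVertex b).eff s (b + 8) 3 = ((q[h] : ℕ) : ℤ) := by
      simp [heff, State.write_apply]
    rw [hV.mem_iff, h3]
    constructor
    · rintro ⟨u, v, ha, hu | ⟨-, hi⟩⟩
      · refine ⟨u, v, ha, ?_⟩
        by_cases huq : u = q[h]
        · refine Or.inr ⟨by rw [huq], ?_⟩
          subst huq
          by_contra hlt'
          exact hj₃ i v (by omega) ha.le_length ha
        · exact Or.inl fun hm => ((hmem u).1 hm).elim hu huq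
      · have := ha.1; omega
    · rintro ⟨u, v, ha, hu | ⟨hu, -⟩⟩
      · exact ⟨u, v, ha, Or.inl fun hm => hu ((hmem u).2 (Or.inl hm))⟩
      · rw [cast_val_inj] at hu
        exact ⟨u, v, ha, Or.inl (hu ▸ hnot)⟩
  · rw [hne _ (by omega), hV.mem_queue]
  · rw [hne _ (by omega), hV.free]
  · obtain ⟨v, hv⟩ := hj₂.resolve_left hj0
    exact ⟨q[h], v, hv, by simp [heff, State.write_apply], (hmem _).2 (Or.inr rfl)⟩

/-- The source has been queued, so its flag correctly tells whether it is selected, and can be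
passed on to the target. The target is not yet queued, as the arc `p` still enters it; it joins the
queue when the count of its unfollowed arcs drops to zero. -/
theorem Visiting.follow (hR : ∀ u v, R u v → ¬ R v u) (hS : IsKernel R S)
    (hE : ∀ u v, R u v → (u, v) ∈ E ∨ (v, u) ∈ E) (hV : Visiting E R S b q h p D s)
    (hp : p ≠ 0) : p ∈ D ∧ ∃ q' p', Visiting E R S b q' h p' (D.erase p) ((followArc b).eff s) := by
  classical
  obtain ⟨u, v, ha, hu, hum⟩ := hV.source hp
  have huq : u ∈ q := List.mem_of_mem_take hum
  obtain ⟨htg, j, hj, hj₁, hj₂, hj₃⟩ := hV.linked.2 p u v ha.le_length ha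
  have hpD : p ∈ D := (hV.mem_iff p).2 ⟨u, v, ha, Or.inr ⟨hu, le_rfl⟩⟩
  have hvD : p ∈ D.filter fun i => ∃ u, Arc E R i u v := Finset.mem_filter.2 ⟨hpD, u, ha⟩
  have hvq : v ∉ q := fun hv => hV.notMem hv ha hpD
  obtain ⟨hbl, hdg, hqu, hr0, hr1, hr2, hr3⟩ := eff_followArc (b := b) s (v := ((v : ℕ) : ℤ))
    (by rw [hV.arc, htg])
  have hfr : ∀ c, c < b + 3 → (followArc b).eff s c = s c := fun c hc => by
    refine Program.eff_eq_of_not_writes s fun hw => ?_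
    simp only [followArc, Program.Writes, or_false] at hw
    omega
  have hcnt : Counted E R b (D.erase p) ((followArc b).eff s) := by
    intro w
    simp only [hdg, cast_val_inj]
    rw [Finset.filter_erase]
    by_cases hw : w = v
    · subst hw
      rw [if_pos rfl, hV.counted w, Finset.card_erase_of_mem hvD, Nat.cast_sub, Nat.cast_one]
      exact Finset.card_pos.2 ⟨p, hvD⟩
    · rw [if_neg hw, hV.counted w, Finset.erase_eq_of_notMem]
      rintro hm
      obtain ⟨-, u', hu'⟩ := Finset.mem_filter.1 hm
      exact hw (hu'.unique hR ha).2
  have hfree : ∀ w : Fin n, (followArc b).eff s (b + 5) (w : ℕ) = 0 ↔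
      ∀ i u', Arc E R i u' w → i ∉ D.erase p → ¬ S u' := by
    intro w
    simp only [hbl, cast_val_inj, ← hu, hV.free_iff hS hE huq]
    have hback : w ≠ v ∨ ¬ S u → (s (b + 5) (w : ℕ) = 0 ↔
        ∀ i u', Arc E R i u' w → i ∉ D.erase p → ¬ S u') := by
      intro hwv
      rw [hV.free]
      constructor
      · intro hf i u' ha' hi
        by_cases hip : i = p
        · subst hip
          obtain ⟨rfl, rfl⟩ := ha'.unique hR ha
          exact hwv.elim (fun h => absurd rfl h) id
        · exact hf i u' ha' fun hiD => hi (Finset.mem_erase.2 ⟨hip, hiD⟩)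
      · exact fun hf i u' ha' hi => hf i u' ha' fun hm => hi (Finset.mem_of_mem_erase hm)
    by_cases hw : w = v
    · by_cases hSu : S u
      · subst hw
        rw [if_pos ⟨rfl, hSu⟩]
        exact iff_of_false one_ne_zero fun hf => hf p u ha (Finset.notMem_erase p D) hSu
      · rw [if_neg (fun h => hSu h.2)]
        exact hback (Or.inr hSu)
    · rw [if_neg (fun h => hw h.1)]
      exact hback (Or.inl hw)
  have hmem : ∀ i, i ∈ D.erase p ↔ ∃ u' v', Arc E R i u' v' ∧
      (u' ∉ q.take h ∨ ((u' : ℕ) : ℤ) = (followArc b).eff s (b + 8) 3 ∧ i ≤ j) := by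
    intro i
    rw [Finset.mem_erase, hV.mem_iff, hr3, ← hu]
    constructor
    · rintro ⟨hip, u', v', ha', hu' | ⟨hu', hi⟩⟩
      · exact ⟨u', v', ha', Or.inl hu'⟩
      · refine ⟨u', v', ha', Or.inr ⟨hu', ?_⟩⟩
        rw [cast_val_inj] at hu'
        subst hu'
        by_contra hlt
        exact hj₃ i v' (by omega) (by omega) ha'
    · rintro ⟨u', v', ha', hu' | ⟨hu', hi⟩⟩
      · refine ⟨?_, u', v', ha', Or.inl hu'⟩
        rintro rfl
        exact hu' ((ha'.unique hR ha).1 ▸ hum)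
      · exact ⟨by omega, u', v', ha', Or.inr ⟨hu', by omega⟩⟩
  have hsource : j ≠ 0 → ∃ u' v', Arc E R j u' v' ∧
      ((u' : ℕ) : ℤ) = (followArc b).eff s (b + 8) 3 ∧ u' ∈ q.take h := by
    intro hj0
    obtain ⟨v', hv'⟩ := hj₂.resolve_left hj0
    exact ⟨u, v', hv', by rw [hr3, hu], hum⟩
  have hr2' : (followArc b).eff s (b + 8) 2 = (j : ℤ) := by rw [hr2, hV.arc, hj]
  have hlink := hV.linked.congr hfr
  have hd1 : s (b + 3) (v : ℕ) = 1 ↔ (followArc b).eff s (b + 3) (v : ℕ) = 0 := by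
    rw [hdg, if_pos rfl]; omega
  have hd2 : ∀ w, w ≠ v → (w ∈ q ↔ (followArc b).eff s (b + 3) (w : ℕ) = 0) := by
    intro w hw
    rw [hdg, if_neg (by rwa [cast_val_inj]), hV.mem_queue]
  refine ⟨hpD, ?_⟩
  by_cases h1 : s (b + 3) (v : ℕ) = 1
  · have htake : (q ++ [v]).take h = q.take h := List.take_append_of_le_length hV.le_length
    refine ⟨q ++ [v], j, hlink, hV.queue.push hvq ?_ ?_, ?_, ?_, hr2', ?_, hcnt, ?_, hfree, ?_⟩
    · rw [hr0, if_pos h1]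
    · intro x
      rw [hqu]
      simp [h1]
    · have := hV.le_length
      rw [List.length_append]
      omega
    · rw [hr1, hV.head]
    · simpa only [htake] using hmem
    · intro w
      rw [List.mem_append, List.mem_singleton]
      by_cases hw : w = v
      · subst hw
        simpa using hd1.1 h1
      · simpa [hw] using hd2 w hw
    · simpa only [htake] using hsource
  · refine ⟨q, j, hlink, hV.queue.congr ?_ ?_, hV.le_length, ?_, hr2', hmem, hcnt, ?_, hfree,
      hsource⟩
    · rw [hr0, if_neg h1]
    · ext x
      rw [hqu, if_neg (fun h => h1 h.2)]
    · rw [hr1, hV.head]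
    · intro w
      by_cases hw : w = v
      · subst hw
        exact iff_of_false hvq fun h => h1 (hd1.2 h)
      · exact hd2 w hw

/-- Every vertex has been queued, by well-founded induction: once all predecessors have been removed
and no arc is current, no unfollowed arc enters the vertex. -/
theorem Visiting.done (hwf : WellFounded R) (hS : IsKernel R S)
    (hE : ∀ u v, R u v → (u, v) ∈ E ∨ (v, u) ∈ E) (hV : Visiting E R S b q q.length 0 D s)
    (v : Fin n) : s (b + 5) (v : ℕ) = 0 ↔ S v := by
  classical
  refine hV.free_iff hS hE ?_
  induction v using hwf.induction with
  | _ v ih =>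
    rw [hV.mem_queue, hV.counted, Nat.cast_eq_zero, Finset.card_eq_zero,
      Finset.filter_eq_empty_iff]
    rintro i hi ⟨u, ha⟩
    obtain ⟨u', v', ha', h | ⟨-, h⟩⟩ := (hV.mem_iff i).1 hi
    · rw [List.take_length] at h
      obtain ⟨rfl, rfl⟩ := ha.unique hwf.asymmetric ha'
      exact h (ih u ha.2.2)
    · have := ha.1; omega

theorem runs_visitAll (hwf : WellFounded R) (hS : IsKernel R S)
    (hE : ∀ u v, R u v → (u, v) ∈ E ∨ (v, u) ∈ E) (hV : Visiting E R S b q 0 0 D s) {N : ℕ}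
    (hN : n + D.card ≤ N) :
    Runs (visitAll b) s N fun s' => ∀ v : Fin n, s' (b + 5) (v : ℕ) = 0 ↔ S v := by
  have := Runs.loop (b := .not (.and (.eq (qreg b 2) (.lit 0)) (.eq (qreg b 0) (qreg b 1))))
    (c := .branch (.eq (qreg b 2) (.lit 0)) (popVertex b) (followArc b))
    -- Each round either removes a vertex from the queue or follows an arc, so vertices not yet
    -- removed plus unfollowed arcs is a decreasing measure.
    (I := fun k s => ∃ q h p D, k = n - h + D.card ∧ Visiting E R S b q h p D s)
    (by simp [popVertex, followArc, Program.LoopFree]) ?_ (s := s) (k := n + D.card)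
    ⟨q, 0, 0, D, by simp, hV⟩ hN
  · refine this.mono ?_
    rintro s' - ⟨⟨l, q, h, p, D, -, hV⟩, hb⟩
    simp only [Test.Holds, Expr.eval, hV.arc, hV.head, hV.queue.2.1, not_not] at hb
    obtain ⟨rfl, rfl⟩ : p = 0 ∧ h = q.length := by omega
    exact hV.done hwf hS hE
  · rintro k s ⟨q, h, p, D, rfl, hV⟩ hb
    have hle := hV.le_length
    simp only [Test.Holds, Expr.eval, hV.arc, hV.head, hV.queue.2.1] at hb
    rw [Program.eff]
    simp only [Test.Holds, Expr.eval, hV.arc]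
    by_cases hp : p = 0
    · subst hp
      obtain ⟨p', hV'⟩ := hV.pop (by omega)
      have : q.length ≤ n := by simpa using hV.queue.1.length_le_card
      refine ⟨n - (h + 1) + D.card, by omega, q, h + 1, p', D, rfl, ?_⟩
      simpa using hV'
    · obtain ⟨hpD, q', p', hV'⟩ := hV.follow hwf.asymmetric hS hE hp
      have : (D.erase p).card < D.card := Finset.card_erase_lt_of_mem hpD
      refine ⟨n - h + (D.erase p).card, by omega, q', h, p', D.erase p, rfl, ?_⟩
      simpa [hp] using hV'

/-- Computes the kernel of the relation that is decided by `T`; afterwards, a vertex `v` belongs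
to the kernel if the cell `v` of the array `b + 5` is zero. -/
def findKernel (T : Expr → Expr → Test) (b : ℕ) : Program :=
  .seq (storeArcs T b) (.seq (initQueue b) (visitAll b))

theorem writes_findKernel {c : ℕ} (h : (findKernel T b).Writes c) : b ≤ c ∧ c ≤ b + 8 := by
  rcases h with h | h | h
  · have := writes_storeArcs h; omega
  · have := writes_initQueue h; omega
  · have := writes_visitAll h; omega

theorem runs_findKernel (hwf : WellFounded R) (hS : IsKernel R S)
    (hRE : ∀ u v, R u v → (u, v) ∈ E ∨ (v, u) ∈ E) {N : ℕ} (hb : 7 ≤ b)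
    (hE : Loaded E s) (hT : Decides T R b s) (hN : n + E.length ≤ N)
    (h₀ : ∀ c, b ≤ c → s c = 0) :
    Runs (findKernel T b) s N fun s' => ∀ v : Fin n, s' (b + 5) (v : ℕ) = 0 ↔ S v := by
  classical
  refine Runs.seq ((runs_storeArcs hwf.asymmetric hb hE hT (by omega) h₀).mono ?_)
  rintro s₁ hf₁ ⟨hL, hC⟩
  have hf₁' : ∀ c, ¬ (b ≤ c ∧ c ≤ b + 3 ∨ c = b + 6) → s₁ c = s c :=
    fun c hc => hf₁ c fun h => hc (writes_storeArcs h)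
  refine Runs.seq ((runs_initQueue (n := n) (by rw [hf₁' 0 (by omega)]; exact hE.1) (by omega)
    (by rw [hf₁' _ (by omega), h₀ _ (by omega)])
    (by rw [hf₁' _ (by omega), h₀ _ (by omega)])).mono ?_)
  rintro s₂ hf₂ ⟨⟨q, hq, hmem⟩, hj⟩
  have hf₂' : ∀ c, ¬ (c = b + 4 ∨ c = b + 7 ∨ c = b + 8) → s₂ c = s₁ c :=
    fun c hc => hf₂ c fun h => hc (writes_initQueue h)
  have hD : ∀ i, i ∈ (Finset.range (E.length + 1)).filter (fun i => ∃ u v, Arc E R i u v) ↔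
      ∃ u v, Arc E R i u v := by
    intro i
    rw [Finset.mem_filter, and_iff_right_iff_imp]
    rintro ⟨u, v, ha⟩
    have := ha.le_length
    simp; omega
  refine runs_visitAll hwf hS hRE (q := q)
    (D := (Finset.range (E.length + 1)).filter fun i => ∃ u v, Arc E R i u v)
    ⟨hL.congr fun c hc => hf₂' c (by omega), hq, Nat.zero_le _, hj 1 (by simp), hj 2 (by simp),
      fun i => ?_, fun v => ?_, fun v => ?_, fun v => ?_, fun h => absurd rfl h⟩ ?_
  · rw [hD]
    simp
  · rw [hf₂' _ (by omega), hC v, Finset.filter_filter]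
    congr 2
    ext i
    simp only [Finset.mem_filter]
    exact and_congr_right fun _ => ⟨fun ⟨u, h⟩ => ⟨⟨u, v, h⟩, u, h⟩, fun h => h.2⟩
  · rw [hf₂' _ (by omega), hmem]
  · rw [hf₂' _ (by omega), hf₁' _ (by omega), h₀ _ (by omega)]
    refine iff_of_true rfl fun i u ha hi => absurd ((hD i).2 ⟨u, v, ha⟩) hi
  · have : ((Finset.range (E.length + 1)).filter fun i => ∃ u v, Arc E R i u v).card ≤
        (Finset.Icc 1 E.length).card := by
      refine Finset.card_le_card fun i hi => ?_
      obtain ⟨u, v, ha⟩ := (hD i).1 hi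
      exact Finset.mem_Icc.2 ⟨ha.1, ha.le_length⟩
    rw [Nat.card_Icc] at this
    omega

end KernelLoop

end RAM

/-! ### The coloring algorithm -/

namespace RAM

section Algorithm

/-- `e₁ < e₂`. -/
def Test.lt (e₁ e₂ : Expr) : Test := .not (.le e₂ e₁)

/-- The disjunction of two tests. -/
def Test.or (b₁ b₂ : Test) : Test := .not (.and (.not b₁) (.not b₂))

theorem Test.holds_lt {s : State} {e₁ e₂ : Expr} :
    (Test.lt e₁ e₂).Holds s ↔ e₁.eval s < e₂.eval s := by
  simp [Test.lt, Test.Holds]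

theorem Test.holds_or {s : State} {b₁ b₂ : Test} :
    (Test.or b₁ b₂).Holds s ↔ b₁.Holds s ∨ b₂.Holds s := by
  simp only [Test.or, Test.Holds]; tauto

variable {n : ℕ} {P Q : Fin n → GridPath} {E : List (Fin n × Fin n)} {s : State}

/-- Computes the ends and the type of a horizontal part; the arrays `a₁, …, a₄` hold the
coordinates of the path. -/
def measure (a₁ a₂ a₃ a₄ d : ℕ) : Program :=
  .seq (.branch (.le (.get a₁ (.reg 8)) (.get a₂ (.reg 8)))
      (.seq (.assign d (.reg 8) (.get a₁ (.reg 8)))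
        (.assign (d + 1) (.reg 8) (.get a₂ (.reg 8))))
      (.seq (.assign d (.reg 8) (.get a₂ (.reg 8)))
        (.assign (d + 1) (.reg 8) (.get a₁ (.reg 8)))))
    (.branch (.and (.lt (.get a₂ (.reg 8)) (.get a₁ (.reg 8)))
        (.lt (.get a₃ (.reg 8)) (.get a₄ (.reg 8)))) (.assign (d + 2) (.reg 8) (.lit 0))
      (.branch (.and (.lt (.get a₂ (.reg 8)) (.get a₁ (.reg 8)))
        (.lt (.get a₄ (.reg 8)) (.get a₃ (.reg 8)))) (.assign (d + 2) (.reg 8) (.lit 1))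
        (.assign (d + 2) (.reg 8) (.lit 2))))

theorem eff_measure {a₁ a₂ a₃ a₄ d : ℕ} {k : ℤ} {p : GridPath} (hd : 8 < d) (h8 : s 8 0 = k)
    (h₁ : a₁ < d ∧ s a₁ k = p.x') (h₂ : a₂ < d ∧ s a₂ k = p.x) (h₃ : a₃ < d ∧ s a₃ k = p.y)
    (h₄ : a₄ < d ∧ s a₄ k = p.y') : (measure a₁ a₂ a₃ a₄ d).eff s =
      ((s.write d k p.lo).write (d + 1) k p.hi).write (d + 2) k p.typ := by
  have d8 : 8 ≠ d ∧ 8 ≠ d + 1 := by omega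
  have d₁ : a₁ ≠ d ∧ a₁ ≠ d + 1 := by omega
  have d₂ : a₂ ≠ d ∧ a₂ ≠ d + 1 := by omega
  have d₃ : a₃ ≠ d ∧ a₃ ≠ d + 1 := by omega
  have d₄ : a₄ ≠ d ∧ a₄ ≠ d + 1 := by omega
  have hs : ∀ x y : ℤ, Program.eff
      (.branch (.and (.lt (.get a₂ (.reg 8)) (.get a₁ (.reg 8)))
          (.lt (.get a₃ (.reg 8)) (.get a₄ (.reg 8)))) (.assign (d + 2) (.reg 8) (.lit 0))
        (.branch (.and (.lt (.get a₂ (.reg 8)) (.get a₁ (.reg 8)))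
          (.lt (.get a₄ (.reg 8)) (.get a₃ (.reg 8)))) (.assign (d + 2) (.reg 8) (.lit 1))
          (.assign (d + 2) (.reg 8) (.lit 2)))) ((s.write d k x).write (d + 1) k y) =
      ((s.write d k x).write (d + 1) k y).write (d + 2) k p.typ := by
    intro x y
    simp only [Program.eff, Test.Holds, Test.holds_lt, Expr.eval, State.write_apply, d8, d₁, d₂,
      d₃, d₄, false_and, if_false, h8, h₁.2, h₂.2, h₃.2, h₄.2, GridPath.typ]
    split_ifs <;> rfl
  rw [measure, Program.eff, ← hs]
  congr 1
  by_cases h : p.x' ≤ p.x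
  · simp [Program.eff, Test.Holds, Expr.eval, State.write_apply, d8, d₂, h8, h₁.2, h₂.2,
      GridPath.lo, GridPath.hi, h]
  · have h' : p.x ≤ p.x' := by omega
    simp [Program.eff, Test.Holds, Expr.eval, State.write_apply, d8, d₁, h8, h₁.2, h₂.2,
      GridPath.lo, GridPath.hi, h, h']

/-- The arrays `l`, `d`, `d + 1` and `d + 2` hold the rows, the ends and the types of the
horizontal parts. -/
def Tabulated (Q : Fin n → GridPath) (l d : ℕ) (s : State) : Prop :=
  ∀ v : Fin n, s l (v : ℕ) = (Q v).y ∧ s d (v : ℕ) = (Q v).lo ∧ s (d + 1) (v : ℕ) = (Q v).hi ∧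
    s (d + 2) (v : ℕ) = (Q v).typ

theorem Tabulated.congr {l d : ℕ} {s' : State} (h : Tabulated Q l d s) (hl : s' l = s l)
    (h₀ : s' d = s d) (h₁ : s' (d + 1) = s (d + 1)) (h₂ : s' (d + 2) = s (d + 2)) :
    Tabulated Q l d s' := by
  unfold Tabulated
  rwa [hl, h₀, h₁, h₂]

/-- Measures the horizontal and the vertical parts of all paths. -/
def measureAll : Program :=
  .count 8 (.get 0 (.lit 0)) (.seq (measure 1 2 3 4 10) (measure 4 3 2 1 13))

theorem writes_measureAll {c : ℕ} (h : measureAll.Writes c) : c = 8 ∨ 10 ≤ c ∧ c ≤ 15 := by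
  simp only [measureAll, measure, Program.count, Program.Writes] at h
  omega

/-- The arrays `1` to `4` hold the coordinates of the paths. -/
def PathsLoaded (P : Fin n → GridPath) (s : State) : Prop :=
  ∀ v : Fin n, s 1 (v : ℕ) = (P v).x' ∧ s 2 (v : ℕ) = (P v).x ∧ s 3 (v : ℕ) = (P v).y ∧
    s 4 (v : ℕ) = (P v).y'

/-- Reflection reverses the order of the four coordinates. The vertical parts are thus handled by
the same code with the arrays in reverse order, and array 2 holds the rows of the reflected paths.
-/
theorem runs_measureAll {N : ℕ} (hn : s 0 0 = (n : ℤ)) (hN : n ≤ N) (hP : PathsLoaded P s)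
    (h8 : s 8 = 0) : Runs measureAll s N fun s' =>
      Tabulated P 3 10 s' ∧ Tabulated (fun v => (P v).flip) 2 13 s' := by
  have hw : ∀ c, Program.Writes c (.seq (measure 1 2 3 4 10) (measure 4 3 2 1 13)) →
      10 ≤ c ∧ c ≤ 15 := by
    intro c h
    simp only [measure, Program.Writes] at h
    omega
  have := Runs.count (a := 8) (e := .get 0 (.lit 0))
    (c := .seq (measure 1 2 3 4 10) (measure 4 3 2 1 13))
    (I := fun k s' => (∀ c < 8, s' c = s c) ∧ ∀ v : Fin n, (v : ℕ) < k →
      (s' 10 (v : ℕ) = (P v).lo ∧ s' 11 (v : ℕ) = (P v).hi ∧ s' 12 (v : ℕ) = (P v).typ) ∧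
      (s' 13 (v : ℕ) = (P v).flip.lo ∧ s' 14 (v : ℕ) = (P v).flip.hi ∧
        s' 15 (v : ℕ) = (P v).flip.typ))
    (s := s) (m := n) (by simp [measure, Program.LoopFree])
    (fun h => by have := hw _ h; omega) ?_ hN ?_ ?_ (by simp [h8])
    ⟨fun _ _ => rfl, fun v hv => by omega⟩
  · refine this.mono ?_
    rintro s' - ⟨hf, h⟩
    refine ⟨fun v => ⟨?_, (h v v.2).1⟩, fun v => ⟨?_, (h v v.2).2⟩⟩
    · rw [hf 3 (by omega), (hP v).2.2.1]
    · rw [hf 2 (by omega), (hP v).2.1]; rfl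
  · intro s' hs'
    rw [Expr.eval, hs' 0 (by omega) (fun h => by have := hw _ h; omega)]
    exact hn
  · rintro k s' i x ⟨hf, h⟩
    refine ⟨fun c hc => by rw [State.write_of_ne _ _ _ _ (by omega), hf c hc], fun v hv => ?_⟩
    simpa [State.write_of_ne] using h v hv
  · rintro k hk s' hs' hk' ⟨hf, h⟩
    obtain ⟨h₁, h₂, h₃, h₄⟩ := hP ⟨k, hk⟩
    rw [← hf 1 (by omega)] at h₁
    rw [← hf 2 (by omega)] at h₂
    rw [← hf 3 (by omega)] at h₃
    rw [← hf 4 (by omega)] at h₄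
    rw [Program.eff, eff_measure (by omega) hk' ⟨by omega, h₁⟩ ⟨by omega, h₂⟩ ⟨by omega, h₃⟩
      ⟨by omega, h₄⟩, eff_measure (p := (P ⟨k, hk⟩).flip) (k := k) (by omega)
      (by simpa [State.write_apply] using hk')
      ⟨by omega, by simpa [State.write_apply, GridPath.flip] using h₄⟩
      ⟨by omega, by simpa [State.write_apply, GridPath.flip] using h₃⟩
      ⟨by omega, by simpa [State.write_apply, GridPath.flip] using h₂⟩
      ⟨by omega, by simpa [State.write_apply, GridPath.flip] using h₁⟩]
    refine ⟨fun c hc => ?_, fun v hv => ?_⟩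
    · iterate 6 rw [State.write_of_ne _ _ _ _ (by omega)]
      exact hf c hc
    · by_cases hvk : (v : ℕ) = k
      · obtain rfl : v = ⟨k, hk⟩ := Fin.ext hvk
        simp [State.write_apply]
      · have := h v (by omega)
        simpa [State.write_apply, hvk] using this

/-- The test for `EarlierThan`. -/
def earlierTest (l d : ℕ) (e₁ e₂ : Expr) : Test :=
  .and (.eq (.get l e₁) (.get l e₂)) (.and (.lt (.get d e₁) (.get d e₂))
    (.and (.lt (.get d e₂) (.get (d + 1) e₁)) (.lt (.get d e₂) (.get (d + 1) e₂))))

theorem holds_earlierTest {l d : ℕ} (hs : Tabulated Q l d s) {e₁ e₂ : Expr} {u v : Fin n}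
    (hu : e₁.eval s = ((u : ℕ) : ℤ)) (hv : e₂.eval s = ((v : ℕ) : ℤ)) :
    (earlierTest l d e₁ e₂).Holds s ↔ EarlierThan Q u v := by
  obtain ⟨h₁, h₂, h₃, h₄⟩ := hs u
  obtain ⟨h₅, h₆, h₇, h₈⟩ := hs v
  simp only [earlierTest, Test.Holds, Test.holds_lt, Expr.eval, hu, hv, h₁, h₂, h₃, h₅, h₆, h₇,
    EarlierThan]

/-- The test for `Blocks`. -/
def blockTest (l d x : ℕ) (extra : Expr → Expr → Test) (e₁ e₂ : Expr) : Test :=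
  .or (extra e₁ e₂) (.and (.eq (.get l e₁) (.get l e₂))
    (.and (.lt (.get d e₂) (.get (d + 1) e₂)) (.and (.lt (.get d e₂) (.get (d + 1) e₁))
      (.or (.lt (.get d e₁) (.get d e₂)) (.and (.eq (.get d e₁) (.get d e₂))
        (.or (.and (.lt (.get (d + 2) e₁) (.get (d + 2) e₂))
            (.not (.and (.eq (.get (d + 2) e₁) (.lit 0))
              (.and (.eq (.get (d + 2) e₂) (.lit 1)) (.eq (.get x e₂) (.lit 1))))))
          (.and (.eq (.get (d + 2) e₁) (.get (d + 2) e₂)) (.lt e₁ e₂))))))))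

theorem holds_blockTest {l d x : ℕ} (hs : Tabulated Q l d s) {ex : Fin n → Prop}
    {extra : Fin n → Fin n → Prop} {T : Expr → Expr → Test} {e₁ e₂ : Expr} {u v : Fin n}
    (hx : s x (v : ℕ) = 1 ↔ ex v) (hT : (T e₁ e₂).Holds s ↔ extra u v)
    (hu : e₁.eval s = ((u : ℕ) : ℤ)) (hv : e₂.eval s = ((v : ℕ) : ℤ)) :
    (blockTest l d x T e₁ e₂).Holds s ↔ Blocks Q ex extra u v := by
  obtain ⟨h₁, h₂, h₃, h₄⟩ := hs u
  obtain ⟨h₅, h₆, h₇, h₈⟩ := hs v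
  simp only [blockTest, Test.Holds, Test.holds_lt, Test.holds_or, Expr.eval, hu, hv, h₁, h₂, h₃,
    h₄, h₅, h₆, h₇, h₈, hx, hT, Blocks, Nat.cast_lt, Fin.val_fin_lt]

/-- The test for `ColExtra`; array `23` holds zero for the vertices selected in the rows. -/
def colExtraTest (e₁ e₂ : Expr) : Test :=
  .and (.eq (.get 12 e₁) (.lit 1)) (.and (.eq (.get 15 e₂) (.lit 0))
    (.and (.eq (.get 2 e₁) (.get 2 e₂)) (.and (.eq (.get 3 e₁) (.get 3 e₂))
      (.eq (.get 23 e₁) (.lit 0)))))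

theorem holds_colExtraTest {H : Fin n → Prop} (h₁ : Tabulated P 3 10 s)
    (h₂ : Tabulated (fun v => (P v).flip) 2 13 s) {e₁ e₂ : Expr} {u v : Fin n}
    (hH : s 23 (u : ℕ) = 0 ↔ H u)
    (hu : e₁.eval s = ((u : ℕ) : ℤ)) (hv : e₂.eval s = ((v : ℕ) : ℤ)) :
    (colExtraTest e₁ e₂).Holds s ↔ ColExtra P H u v := by
  obtain ⟨h₃, -, -, h₄⟩ := h₁ u
  obtain ⟨h₅, -, -, -⟩ := h₁ v
  obtain ⟨h₆, -, -, -⟩ := h₂ u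
  obtain ⟨h₇, -, -, h₈⟩ := h₂ v
  simp only [Nat.reduceAdd] at h₄ h₈
  simp only [colExtraTest, Test.Holds, Expr.eval, hu, hv, h₃, h₄, h₅, h₆, h₇, h₈, hH, ColExtra]
  rfl

/-- Writes the color of the vertex in the cell `0` of array `9`. -/
def writeColor : Program :=
  .branch (.eq (.get 23 (.reg 9)) (.lit 0))
    (.branch (.eq (.get 34 (.reg 9)) (.lit 0)) (.assign 7 (.reg 9) (.lit 3))
      (.assign 7 (.reg 9) (.lit 2)))
    (.branch (.eq (.get 34 (.reg 9)) (.lit 0)) (.assign 7 (.reg 9) (.lit 1))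
      (.assign 7 (.reg 9) (.lit 0)))

theorem runs_writeColors {N : ℕ} {H W : Fin n → Prop} (hn : s 0 0 = (n : ℤ)) (hN : n ≤ N)
    (hH : ∀ v : Fin n, s 23 (v : ℕ) = 0 ↔ H v) (hW : ∀ v : Fin n, s 34 (v : ℕ) = 0 ↔ W v)
    (h9 : s 9 = 0) :
    Runs (.count 9 (.get 0 (.lit 0)) writeColor) s N fun s' =>
      Outputs s' (selectionColor H W) := by
  have := Runs.count (a := 9) (e := .get 0 (.lit 0)) (c := writeColor)
    (I := fun k s' => ∀ v : Fin n, (v : ℕ) < k →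
      s' 7 (v : ℕ) = ((selectionColor H W v : ℕ) : ℤ))
    (s := s) (m := n) (by simp [writeColor, Program.LoopFree])
    (by simp [writeColor, Program.Writes]) ?_ hN ?_ ?_ (by simp [h9]) (fun v hv => by omega)
  · exact this.mono fun s' _ h v => h v v.2
  · intro s' hs'
    rw [Expr.eval, hs' 0 (by omega) (by simp [writeColor, Program.Writes])]
    exact hn
  · intro k s' i x h v hv
    rw [State.write_of_ne _ _ _ _ (by omega)]
    exact h v hv
  · intro k hk s' hs' hk' h v hv
    have h23 : s' 23 k = 0 ↔ H ⟨k, hk⟩ := by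
      rw [hs' 23 (by omega) (by simp [writeColor, Program.Writes]), ← hH]
    have h34 : s' 34 k = 0 ↔ W ⟨k, hk⟩ := by
      rw [hs' 34 (by omega) (by simp [writeColor, Program.Writes]), ← hW]
    have heff : writeColor.eff s' = s'.write 7 k ((selectionColor H W ⟨k, hk⟩ : ℕ) : ℤ) := by
      by_cases h₁ : H ⟨k, hk⟩ <;> by_cases h₂ : W ⟨k, hk⟩ <;>
        simp [writeColor, Program.eff, Test.Holds, Expr.eval, hk', h23, h34, h₁, h₂,
          selectionColor]
    rw [heff, State.write_apply]
    by_cases hvk : (v : ℕ) = k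
    · obtain rfl : v = ⟨k, hk⟩ := Fin.ext hvk
      simp
    · simpa [hvk] using h v (by omega)

/-- The coloring algorithm. -/
def colorProgram : Program :=
  .seq measureAll
    (.seq (markEnds (earlierTest 3 10) 16)
      (.seq (findKernel (blockTest 3 10 16 fun _ _ => .lt (.lit 0) (.lit 0)) 18)
        (.seq (markEnds (fun e₁ e₂ =>
            .and (earlierTest 2 13 e₁ e₂) (.not (.eq (.get 23 e₂) (.lit 0)))) 27)
          (.seq (findKernel (blockTest 2 13 27 colExtraTest) 29)
            (.count 9 (.get 0 (.lit 0)) writeColor)))))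

/-- All four relations, the two of being earlier and the two of blocking, hold only between vertices
whose paths meet, so scanning the edge list finds all their pairs. Each marking or kernel stage
works in fresh zero arrays above those that its test reads; the kernel stages at 18 and 29 leave
their flags in arrays 23 and 34. -/
theorem runs_colorProgram {N : ℕ} {H W : Fin n → Prop} (hE : Loaded E s) (hP : PathsLoaded P s)
    (h₀ : ∀ c, 7 ≤ c → s c = 0) (hN : n + E.length ≤ N)
    (hmeet : ∀ u v, u ≠ v → (P u).Meets (P v) → (u, v) ∈ E ∨ (v, u) ∈ E)
    (hH : IsKernel (RowBlocks P) H) (hW : IsKernel (ColBlocks P H) W) :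
    Runs colorProgram s N fun s' => Outputs s' (selectionColor H W) := by
  have hrow : ∀ u v, EarlierThan P u v → (u, v) ∈ E ∨ (v, u) ∈ E := by
    intro u v h
    refine hmeet u v (by rintro rfl; exact lt_irrefl _ h.2.1) (Or.inl ?_)
    simp only [EarlierThan, GridPath.RowShare] at *; omega
  have hcol : ∀ u v, EarlierThan (fun v => (P v).flip) u v → (u, v) ∈ E ∨ (v, u) ∈ E := by
    intro u v h
    refine hmeet u v (by rintro rfl; exact lt_irrefl _ h.2.1) (Or.inr ?_)
    simp only [EarlierThan, GridPath.RowShare] at *; omega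
  have hrowE : ∀ u v, RowBlocks P u v → (u, v) ∈ E ∨ (v, u) ∈ E := fun u v h =>
    hmeet u v (by rintro rfl; exact wellFounded_rowBlocks.irrefl.irrefl u h)
      (Or.inl (h.rowShare id))
  have hcolE : ∀ u v, ColBlocks P H u v → (u, v) ∈ E ∨ (v, u) ∈ E := by
    intro u v h
    refine hmeet u v (by rintro rfl; exact wellFounded_colBlocks.irrefl.irrefl u h) ?_
    by_cases hx : ColExtra P H u v
    -- Such a pair shares a row edge rather than a column edge: both horizontal parts go right from
    -- the common bend, while the vertical parts go in opposite directions.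
    · left
      obtain ⟨h₁, h₂, h₃, h₄, -⟩ := hx
      rw [GridPath.typ_eq_one] at h₁
      rw [GridPath.typ_eq_zero] at h₂
      simp only [GridPath.RowShare, GridPath.lo, GridPath.hi, GridPath.flip] at *
      omega
    · exact Or.inr (h.rowShare hx)
  refine Runs.seq ((runs_measureAll hE.1 (by omega) hP (h₀ 8 (by omega))).mono ?_)
  rintro s₁ hf₁ ⟨hA, hB⟩
  replace hf₁ : ∀ c, ¬ (c = 8 ∨ 10 ≤ c ∧ c ≤ 15) → s₁ c = s c :=
    fun c hc => hf₁ c fun h => hc (writes_measureAll h)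
  have hE₁ : Loaded E s₁ := hE.congr fun c hc => hf₁ c (by omega)
  refine Runs.seq ((runs_markEnds (R := EarlierThan P) (k := 16) le_rfl (by omega) hE₁ ?_
    (by omega) (by rw [hf₁ _ (by omega), h₀ _ (by omega)])
    (by rw [hf₁ _ (by omega), h₀ _ (by omega)])).mono ?_)
  · intro s' hs' e₁ e₂ u v hu hv
    exact holds_earlierTest (hA.congr (hs' _ (by omega)) (hs' _ (by omega)) (hs' _ (by omega))
      (hs' _ (by omega))) hu hv
  rintro s₂ hf₂ hM
  replace hf₂ : ∀ c, ¬ (c = 16 ∨ c = 17) → s₂ c = s₁ c :=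
    fun c hc => hf₂ c fun h => hc (writes_markEnds.1 h)
  refine Runs.seq ((runs_findKernel wellFounded_rowBlocks hH hrowE (by omega)
    (hE₁.congr fun c hc => hf₂ c (by omega)) ?_ hN fun c hc => by
      rw [hf₂ _ (by omega), hf₁ _ (by omega), h₀ _ (by omega)]).mono ?_)
  · intro s' hs' e₁ e₂ u v hu hv
    have hs'' : ∀ c < 16, s' c = s₁ c := fun c hc => by
      rw [hs' c (by omega), hf₂ c (by omega)]
    refine holds_blockTest (hA.congr (hs'' _ (by omega)) (hs'' _ (by omega)) (hs'' _ (by omega))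
      (hs'' _ (by omega))) ?_ ?_ hu hv
    · rw [hs' 16 (by omega), hM v]
      exact ⟨fun ⟨z, _, hz⟩ => ⟨z, hz⟩, fun ⟨z, hz⟩ => ⟨z, hrow z v hz, hz⟩⟩
    · simp [Test.holds_lt, Expr.eval]
  rintro s₃ hf₃ hH₃
  replace hf₃ : ∀ c, ¬ (18 ≤ c ∧ c ≤ 26) → s₃ c = s₂ c :=
    fun c hc => hf₃ c fun h => hc (writes_findKernel h)
  have hf₃₁ : ∀ c < 16, s₃ c = s₁ c := fun c hc => by rw [hf₃ c (by omega), hf₂ c (by omega)]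
  have hE₃ : Loaded E s₃ := hE₁.congr fun c hc => hf₃₁ c (by omega)
  have h₀₃ : ∀ c, c = 9 ∨ 27 ≤ c → s₃ c = 0 := fun c hc => by
    rw [hf₃ _ (by omega), hf₂ _ (by omega), hf₁ _ (by omega), h₀ _ (by omega)]
  refine Runs.seq ((runs_markEnds
    (R := fun u v => EarlierThan (fun v => (P v).flip) u v ∧ ¬ H v) (k := 27) le_rfl (by omega)
    hE₃ ?_ (by omega) (h₀₃ _ (by omega)) (h₀₃ _ (by omega))).mono ?_)
  · intro s' hs' e₁ e₂ u v hu hv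
    have hs'' : ∀ c < 16, s' c = s₁ c := fun c hc => by
      rw [hs' c (by omega), hf₃₁ c (by omega)]
    have h := holds_earlierTest (hB.congr (hs'' _ (by omega)) (hs'' _ (by omega))
      (hs'' _ (by omega)) (hs'' _ (by omega))) hu hv
    rw [Test.Holds, h, Test.Holds, Test.Holds, Expr.eval, Expr.eval, hv, hs' 23 (by omega), hH₃ v]
  rintro s₄ hf₄ hM₄
  replace hf₄ : ∀ c, ¬ (c = 27 ∨ c = 28) → s₄ c = s₃ c :=
    fun c hc => hf₄ c fun h => hc (writes_markEnds.1 h)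
  refine Runs.seq ((runs_findKernel wellFounded_colBlocks hW hcolE (by omega)
    (hE₃.congr fun c hc => hf₄ c (by omega)) ?_ hN fun c hc => by
      rw [hf₄ _ (by omega), h₀₃ _ (by omega)]).mono ?_)
  · intro s' hs' e₁ e₂ u v hu hv
    have hs'' : ∀ c < 16, s' c = s₁ c := fun c hc => by
      rw [hs' c (by omega), hf₄ c (by omega), hf₃₁ c (by omega)]
    have hB' := hB.congr (hs'' _ (by omega)) (hs'' _ (by omega)) (hs'' _ (by omega))
      (hs'' _ (by omega))
    refine holds_blockTest hB' ?_ (holds_colExtraTest (hA.congr (hs'' _ (by omega))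
      (hs'' _ (by omega)) (hs'' _ (by omega)) (hs'' _ (by omega))) hB' ?_ hu hv) hu hv
    · rw [hs' 27 (by omega), hM₄ v]
      exact ⟨fun ⟨z, _, hz⟩ => ⟨z, hz⟩, fun ⟨z, hz⟩ => ⟨z, hcol z v hz.1, hz⟩⟩
    · rw [hs' 23 (by omega), hf₄ 23 (by omega), hH₃ u]
  rintro s₅ hf₅ hW₅
  replace hf₅ : ∀ c, ¬ (29 ≤ c ∧ c ≤ 37) → s₅ c = s₄ c :=
    fun c hc => hf₅ c fun h => hc (writes_findKernel h)
  refine runs_writeColors ?_ (by omega) (fun v => ?_) hW₅ ?_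
  · rw [hf₅ 0 (by omega), hf₄ 0 (by omega)]
    exact hE₃.1
  · rw [hf₅ 23 (by omega), hf₄ 23 (by omega), hH₃ v]
  · rw [hf₅ 9 (by omega), hf₄ 9 (by omega), h₀₃ 9 (by omega)]

theorem cells_apply (l : List ℤ) (i : ℕ) : cells l (i : ℤ) = l.getD i 0 := by
  simp [cells]

theorem loaded_input : Loaded E (input P E) := by
  refine ⟨?_, ?_, fun e he => ⟨?_, ?_⟩⟩
  · exact cells_apply _ 0
  · exact cells_apply _ 1
  · exact (cells_apply _ e).trans (by simp [he])
  · exact (cells_apply _ e).trans (by simp [he])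

theorem pathsLoaded_input : PathsLoaded P (input P E) := by
  intro v
  refine ⟨?_, ?_, ?_, ?_⟩ <;> exact (cells_apply _ v).trans (by simp)

theorem input_eq_zero {c : ℕ} (hc : 7 ≤ c) : input P E c = 0 := by
  obtain ⟨d, rfl⟩ := Nat.exists_eq_add_of_le' hc
  rfl

end Algorithm

end RAM

/-! ### Edge lists and the main theorem -/

theorem IsEdgeList.mem_or_mem {V : Type*} {G : SimpleGraph V} {E : List (V × V)}
    (h : IsEdgeList G E) {u v : V} (huv : G.Adj u v) : (u, v) ∈ E ∨ (v, u) ∈ E := by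
  obtain ⟨⟨x, y⟩, he, hxy⟩ := List.mem_map.1 ((h.2 s(u, v)).2 huv)
  rcases Sym2.eq_iff.1 hxy with ⟨rfl, rfl⟩ | ⟨rfl, rfl⟩
  · exact Or.inl he
  · exact Or.inr he

/-- The absence of repetitions matters only here, to turn a time bound in the length of the list
into one in the number of edges. -/
theorem IsEdgeList.length_eq {V : Type*} {G : SimpleGraph V} {E : List (V × V)}
    (h : IsEdgeList G E) : E.length = G.edgeSet.ncard := by
  classical
  have : G.edgeSet = ((E.map fun e => s(e.1, e.2)).toFinset : Set (Sym2 V)) := by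
    ext e
    simpa using (h.2 e).symm
  rw [this, Set.ncard_coe_finset, List.toFinset_card_of_nodup h.1, List.length_map]

theorem mainTheorem1 :
    (∀ (V : Type*) [Finite V] (G : SimpleGraph V), IsB1EPG G → CliqueColorable G 4) ∧
    (∃ (prog : RAM.Program) (C : ℕ),
      ∀ (n : ℕ) (G : SimpleGraph (Fin n)) (P : Fin n → GridPath) (E : List (Fin n × Fin n)),
        IsB1EPGRepresentation G P → IsEdgeList G E →
        ∃ (t : ℕ) (s : RAM.State) (f : Fin n → Fin 4),
          RAM.Exec prog (RAM.input P E) t s ∧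
          t ≤ C * (n + G.edgeSet.ncard + 1) ∧
          RAM.Outputs s f ∧
          IsCliqueColoring G f ∧
          ∃ c : Fin 4, G.IsIndepSet {v | f v = c}) := by
  refine ⟨fun V _ G hG => hG.cliqueColorable, RAM.colorProgram, RAM.colorProgram.bound, ?_⟩
  intro n G P E hP hE
  have hG := hP.represents
  obtain ⟨H, hH⟩ := exists_isKernel (wellFounded_rowBlocks (P := P))
  obtain ⟨W, hW⟩ := exists_isKernel (wellFounded_colBlocks (P := P) (H := H))
  obtain ⟨t, s, he, ht, hs⟩ := RAM.runs_colorProgram (RAM.loaded_input (P := P) (E := E))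
    RAM.pathsLoaded_input (fun c hc => RAM.input_eq_zero hc) le_rfl
    (fun u v huv h => hE.mem_or_mem ((hG u v huv).2 h)) hH hW
  rw [hE.length_eq] at ht
  exact ⟨t, s, _, he, ht, hs, isCliqueColoring_selectionColor hG hH hW, 3,
    isIndepSet_selectionColor hG hH hW⟩
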